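/- Let $\mathbb K$ be a field of characteristic $p>2$ and let $(\mathfrak a,[p|2p]_{\mathfrak a})$ be a finite-dimensional restricted Lie superalgebra over $\mathbb K$ (the identity $[a,[a,a]]=0$ for odd $a$ is part of the definition of a Lie superalgebra), equipped with an even, non-degenerate, super anti-symmetric, closed bilinear form $\omega_{\mathfrak a}$ (an orthosymplectic quasi-Frobenius structure). Here a $p|2p$-structure is a $p$-map $a\mapsto a^{[p]}$ on $\mathfrak a_{\bar 0}$ (i.e. $p$-homogeneous, with $(a+b)^{[p]}=a^{[p]}+b^{[p]}+\sum_{i=1}^{p-1}s_i(a,b)$, where $(\mathrm{ad}_{\mu a+b})^{p-1}(a)=\sum_{i=1}^{p-1} i\,s_i(a,b)\mu^{i-1}$) such that $\mathrm{ad}_{a^{[p]}}=(\mathrm{ad}_a)^p$ on all of $\mathfrak a$ for $a\in\mathfrak a_{\bar0}$, together with $a^{[2p]}:=(\tfrac12[a,a])^{[p]}$ for odd $a$. Let $\mathscr D$ be an even derivation of $\mathfrak a$ that is restricted, i.e. $\mathscr D(a^{[p]})=(\mathrm{ad}_a)^{p-1}(\mathscr D(a))$ for $a\in\mathfrak a_{\bar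 0}$, and let $\mathscr D^*$ be its adjoint, $\omega_{\mathfrak a}(\mathscr D(a),b)=\omega_{\mathfrak a}(a,\mathscr D^*(b))$. Let $\lambda\in\mathbb K$ and let $P:\mathfrak a_{\bar 0}\to\mathbb K$ be a map. Put $$C(a,b)=\omega_{\mathfrak a}((\mathscr D+\mathscr D^*)(a),b),\qquad \Omega(a,b)=\omega_{\mathfrak a}\bigl((\mathscr D^2+2\mathscr D^*\mathscr D+{\mathscr D^*}^2+\lambda(\mathscr D+\mathscr D^*))(a),b\bigr)\quad(a,b\in\mathfrak a),$$ $$T(a)=\omega_{\mathfrak a}\bigl((\mathscr D+\mathscr D^*)(a),(\mathrm{ad}_a)^{p-2}(\mathscr D(a))\bigr)+\lambda P(a)\quad(a\in\mathfrak a_{\bar 0}).$$ A restricted $2$-cochain of $\mathfrak a$ with trivial coefficients is a pair $(\varphi,\theta)$ of a super anti-symmetric bilinear form $\varphi$ on $\mathfrak a$ and a map $\theta:\mathfrak a_{\bar0}\to\mathbb K$ with $\theta(ca)=c^p\theta(a)$ for $c\in\mathbb K$ and $$\theta(a+b)=\theta(a)+\theta(b)+\sum_{\substack{x_k\in\{a,b\}\\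 x_1=a,\ x_2=b}}\frac1{\pi\{a\}}\,\varphi\bigl([[\dots[x_1,x_2],\dots],x_{p-1}],x_p\bigr),$$ where $\pi\{a\}$ is the number of $k$ with $x_k=a$. It is a restricted $2$-cocycle if $\varphi$ is a Chevalley–Eilenberg cocycle and $\varphi(a,b^{[p]})=\varphi([[\dots[a,b],\dots],b],b)$ ($p-1$ brackets with $b$) for all $a,b\in\mathfrak a_{\bar0}$; it is a restricted $2$-coboundary if for some linear $\chi:\mathfrak a\to\mathbb K$ one has $\varphi(a,b)=\chi([a,b])$ for $a,b\in\mathfrak a$ and $\theta(a)=\chi(a^{[p]})$ for $a\in\mathfrak a_{\bar0}$. **Theorem 3.1 ($\mathscr D_{\bar 0}$-extension, orthosymplectic case).** Assume that $(\Omega,T)$ is a restricted $2$-coboundary and $(C,P)$ is a restricted $2$-cocycle. Then there exists an even element $Z_\Omega\in\mathfrak a_{\bar 0}$ with $$\Omega(a,b)=\omega_{\mathfrak a}(Z_\Omega,[a,b])\ \ (a,b\in\mathfrak a),\qquad T(a)=\omega_{\mathfrak a}(Z_\Omega,a^{[p]})\ \ (a\in\mathfrak a_{\bar 0}),$$ and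 for every such $Z_\Omega$ the following holds. (i) On $\mathfrak g=\mathbb Kx\oplus\mathfrak a\oplus\mathbb Kx^*$, with $x,x^*$ even, there is a Lie superalgebra structure with $$[x,x^*]=\lambda x,\quad [x,a]=0,\quad [a,b]=[a,b]_{\mathfrak a}+\omega_{\mathfrak a}(\mathscr D(a)+\mathscr D^*(a),b)\,x,\quad [x^*,a]=\mathscr D(a)+\omega_{\mathfrak a}(Z_\Omega,a)\,x\qquad(a,b\in\mathfrak a),$$ and there is an even, non-degenerate, super anti-symmetric closed form $\omega_{\mathfrak g}$ on $\mathfrak g$ that extends $\omega_{\mathfrak a}$ and satisfies $\omega_{\mathfrak g}(\mathfrak a,x)=\omega_{\mathfrak g}(\mathfrak a,x^*)=0$, $\omega_{\mathfrak g}(x^*,x)=1$, $\omega_{\mathfrak g}(x,x)=\omega_{\mathfrak g}(x^*,x^*)=0$. (ii) Let $\gamma\in\mathbb K$ and $a_0\in\mathfrak a_{\bar 0}$ be such that $\mathscr D^p=\gamma\mathscr D+\mathrm{ad}_{a_0}$ and $\mathscr D(a_0)=0$ (the $p$-property of $\mathscr D$), and let $b_0\in\mathfrak a_{\bar 0}$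 and $\tilde\lambda,\sigma,\delta\in\mathbb K$. Suppose that one of the following holds: (a) $\lambda\ne0$, $\gamma=\lambda^{p-1}$, $\delta=0$, $\tilde\lambda=\lambda^{-1}\omega_{\mathfrak a}(Z_\Omega,a_0)$, $\sigma=\lambda^{-1}\omega_{\mathfrak a}(Z_\Omega,b_0)$, $\mathscr D(b_0)=\mathscr D^*(b_0)=0$, $b_0$ is in the centre of $\mathfrak a$, and $\mathscr D^*(a_0)=\sum_{i=1}^{p-1}(-1)^{p-1-i}\lambda^{p-1-i}{\mathscr D^*}^i(Z_\Omega)$; (b) $\lambda=0$, $\delta=0$, $\omega_{\mathfrak a}(Z_\Omega,a_0)=\omega_{\mathfrak a}(Z_\Omega,b_0)=0$, $\mathscr D(b_0)=\mathscr D^*(b_0)=0$, $b_0$ is in the centre of $\mathfrak a$, and $\mathscr D^*(a_0)+\gamma Z_\Omega={\mathscr D^*}^{p-1}(Z_\Omega)$; (c) $\lambda=0$, $\delta\neq0$, $\mathscr D=-\delta^{-1}\mathrm{ad}_{b_0}$, $\omega_{\mathfrak a}(Z_\Omega,a_0)=\omega_{\mathfrak a}(Z_\Omega,b_0)=0$,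 $\mathscr D(b_0)=0$, $\mathscr D^*(b_0)=-\delta Z_\Omega$, and $\mathscr D^*(a_0)+\gamma Z_\Omega={\mathscr D^*}^{p-1}(Z_\Omega)$. Then there is a $p|2p$-structure on $\mathfrak g$ with $$a^{[p]_{\mathfrak g}}=a^{[p]_{\mathfrak a}}+P(a)x\ \ (a\in\mathfrak a_{\bar 0}),\qquad (x^*)^{[p]_{\mathfrak g}}=\gamma x^*+a_0+\tilde\lambda x,\qquad x^{[p]_{\mathfrak g}}=b_0+\sigma x+\delta x^*.$$ -/

import Mathlib

open scoped BigOperators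

/-- The sign `(-1)^{|a||b|}` attached to two parities. -/
def superSign (K : Type*) [Field K] (i j : ZMod 2) : K :=
  if i = 1 ∧ j = 1 then -1 else 1

/-- A Lie superalgebra structure on the `K`-vector space `V = V₀ ⊕ V₁` (with `gr 0 = V₀` the even
part and `gr 1 = V₁` the odd part), where `K` has characteristic different from `2`.  The identity
`[a,[a,a]] = 0` for odd `a` is part of the definition since in characteristic `3` it does not follow
from the Jacobi identity. -/
structure LieSuperalgebra (K V : Type*) [Field K] [AddCommGroup V] [Module K V] where
  gr : ZMod 2 → Submodule K V
  isCompl : IsCompl (gr 0) (gr 1)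
  bracket : V →ₗ[K] V →ₗ[K] V
  bracket_mem : ∀ i j : ZMod 2, ∀ a ∈ gr i, ∀ b ∈ gr j, bracket a b ∈ gr (i + j)
  skew : ∀ i j : ZMod 2, ∀ a ∈ gr i, ∀ b ∈ gr j,
    bracket a b = -(superSign K i j • bracket b a)
  jacobi : ∀ i j k : ZMod 2, ∀ a ∈ gr i, ∀ b ∈ gr j, ∀ c ∈ gr k,
    bracket a (bracket b c) =
      bracket (bracket a b) c + superSign K i j • bracket b (bracket a c)
  odd_cube : ∀ a ∈ gr 1, bracket a (bracket a a) = 0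

section Ad

variable {K V : Type*} [Field K] [AddCommGroup V] [Module K V]

/-- `adCoeff B a b c n j` is the coefficient of `μ ^ j` in the polynomial expression
`(ad_{μ a + b})^n (c)` in the variable `μ`, where `ad_u v = B u v`
(see `pow_ad_eq_sum_adCoeff`). -/
def adCoeff (B : V →ₗ[K] V →ₗ[K] V) (a b c : V) : ℕ → ℕ → V
  | 0, 0 => c
  | 0, _ + 1 => 0
  | n + 1, 0 => B b (adCoeff B a b c n 0)
  | n + 1, j + 1 => B a (adCoeff B a b c n j) + B b (adCoeff B a b c n (j + 1))

theorem adCoeff_eq_zero (B : V →ₗ[K] V →ₗ[K] V) (a b c : V) :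
    ∀ n j : ℕ, n < j → adCoeff B a b c n j = 0 := by
  intro n
  induction n with
  | zero =>
    intro j hj
    cases j with
    | zero => omega
    | succ j => rfl
  | succ n ih =>
    intro j hj
    cases j with
    | zero => omega
    | succ j =>
      simp only [adCoeff]
      rw [ih j (by omega), ih (j + 1) (by omega)]
      simp

theorem pow_ad_eq_sum_adCoeff (B : V →ₗ[K] V →ₗ[K] V) (a b c : V) (μ : K) (n : ℕ) :
    (B (μ • a + b) ^ n) c = ∑ j ∈ Finset.range (n + 1), μ ^ j • adCoeff B a b c n j := by
  induction n with
  | zero => simp [adCoeff]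
  | succ n ih =>
    rw [pow_succ', Module.End.mul_apply, ih, Finset.sum_range_succ' _ (n + 1)]
    simp only [adCoeff, map_sum, map_smul, map_add, LinearMap.add_apply, LinearMap.smul_apply,
      smul_add, Finset.sum_add_distrib, pow_zero, one_smul]
    have h1 : ∑ j ∈ Finset.range (n + 1), μ ^ j • μ • (B a) (adCoeff B a b c n j)
        = ∑ j ∈ Finset.range (n + 1), μ ^ (j + 1) • (B a) (adCoeff B a b c n j) := by
      refine Finset.sum_congr rfl fun j _ => ?_
      rw [smul_smul, pow_succ]
    have h2 : ∑ j ∈ Finset.range (n + 1), μ ^ j • (B b) (adCoeff B a b c n j)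
        = ∑ j ∈ Finset.range (n + 1), μ ^ (j + 1) • (B b) (adCoeff B a b c n (j + 1))
          + (B b) (adCoeff B a b c n 0) := by
      have h3 := Finset.sum_range_succ' (fun j => μ ^ j • (B b) (adCoeff B a b c n j)) (n + 1)
      rw [Finset.sum_range_succ, adCoeff_eq_zero B a b c n (n + 1) (by omega)] at h3
      simpa using h3
    rw [h1, h2, add_assoc]

/-- The elements `s_i(a,b)`, determined by
`(ad_{μ a + b})^{p-1}(a) = ∑_{1 ≤ i ≤ p-1} i s_i(a,b) μ^{i-1}`. -/
def sElem (p : ℕ) (B : V →ₗ[K] V →ₗ[K] V) (a b : V) (i : ℕ) : V :=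
  (i : K)⁻¹ • adCoeff B a b a (p - 1) (i - 1)

end Ad

section Restricted

variable {K V : Type*} [Field K] [AddCommGroup V] [Module K V]

/-- A `p|2p`-structure on a Lie superalgebra: a map `[p]` on the even part together with
the map `[2p]` on the odd part given by `a ↦ (a²)^{[p]}`, where `a² = ½[a,a]`. -/
structure PTwoPStructure (p : ℕ) (L : LieSuperalgebra K V) where
  pMap : L.gr 0 → L.gr 0
  twoPMap : L.gr 1 → L.gr 0
  ad_pMap : ∀ (a : L.gr 0) (b : V),
    L.bracket (pMap a : V) b = (L.bracket (a : V) ^ p) b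
  pMap_smul : ∀ (c : K) (a : L.gr 0), pMap (c • a) = c ^ p • pMap a
  pMap_add : ∀ a b : L.gr 0,
    (pMap (a + b) : V) = (pMap a : V) + (pMap b : V)
      + ∑ i ∈ Finset.Icc 1 (p - 1), sElem p L.bracket (a : V) (b : V) i
  twoPMap_eq : ∀ (a : L.gr 1) (u : L.gr 0),
    (u : V) = (2 : K)⁻¹ • L.bracket (a : V) (a : V) → twoPMap a = pMap u

/-- `φ` is super anti-symmetric. -/
def IsSuperAntisymmetric (L : LieSuperalgebra K V) (φ : LinearMap.BilinForm K V) : Prop :=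
  ∀ i j : ZMod 2, ∀ a ∈ L.gr i, ∀ b ∈ L.gr j, φ a b = -(superSign K i j * φ b a)

/-- The Chevalley--Eilenberg `2`-cocycle condition with values in the trivial module `K`. -/
def IsClosedForm (L : LieSuperalgebra K V) (φ : LinearMap.BilinForm K V) : Prop :=
  ∀ i j k : ZMod 2, ∀ a ∈ L.gr i, ∀ b ∈ L.gr j, ∀ c ∈ L.gr k,
    superSign K i k * φ a (L.bracket b c) + superSign K k j * φ c (L.bracket a b)
      + superSign K j i * φ b (L.bracket c a) = 0

/-- `φ` is even: it vanishes on pairs of elements of different parities. -/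
def IsEvenForm (L : LieSuperalgebra K V) (φ : LinearMap.BilinForm K V) : Prop :=
  ∀ a ∈ L.gr 0, ∀ b ∈ L.gr 1, φ a b = 0 ∧ φ b a = 0

/-- `(L, ω)` is orthosymplectic quasi-Frobenius: `ω` is an even, non-degenerate,
super anti-symmetric closed form. -/
structure IsOrthosymplecticQuasiFrobenius (L : LieSuperalgebra K V)
    (ω : LinearMap.BilinForm K V) : Prop where
  antisymm : IsSuperAntisymmetric L ω
  closed : IsClosedForm L ω
  even : IsEvenForm L ω
  nondegenerate : ω.Nondegenerate

/-- The sum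
`∑ (1/π(a)) φ([[…[x₁,x₂],x₃]…,x_{p-1}],x_p)` over all words `x₁ … x_p` in the letters `a`, `b`
with `x₁ = a`, `x₂ = b`, where `π(a)` is the number of letters equal to `a`.
A word is encoded by `w = (x₃,…,x_{p-1})` and `z = x_p`, with `true` standing for `a`. -/
def starSum (p : ℕ) (L : LieSuperalgebra K V) (φ : LinearMap.BilinForm K V) (a b : V) : K :=
  ∑ w : Fin (p - 3) → Bool, ∑ z : Bool,
    ((1 + (Finset.univ.filter fun i => w i = true).card + (if z then 1 else 0) : ℕ) : K)⁻¹ *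
      φ ((List.ofFn fun i => if w i then a else b).foldl (fun u v => L.bracket u v)
          (L.bracket a b))
        (if z then a else b)

/-- `θ` has the `*`-property with respect to `φ`, with values in the trivial module `K` (so that
all the terms in which some element acts on a value of `φ` vanish). -/
structure HasStarProperty (p : ℕ) (L : LieSuperalgebra K V) (φ : LinearMap.BilinForm K V)
    (θ : L.gr 0 → K) : Prop where
  smul : ∀ (c : K) (a : L.gr 0), θ (c • a) = c ^ p * θ a
  add : ∀ a b : L.gr 0, θ (a + b) = θ a + θ b + starSum p L φ (a : V) (b : V)

/-- `(φ, θ) ∈ C²_*(L; K)`. -/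
structure IsRestrictedCochain (p : ℕ) (L : LieSuperalgebra K V) (φ : LinearMap.BilinForm K V)
    (θ : L.gr 0 → K) : Prop where
  antisymm : IsSuperAntisymmetric L φ
  star : HasStarProperty p L φ θ

/-- `(φ, θ) ∈ Z²_*(L; K)`: a restricted cochain with `d_{CE} φ = 0` and `Ind²(φ, θ) = 0`. -/
structure IsRestrictedCocycle {p : ℕ} {L : LieSuperalgebra K V} (R : PTwoPStructure p L)
    (φ : LinearMap.BilinForm K V) (θ : L.gr 0 → K) : Prop extends
    IsRestrictedCochain p L φ θ where
  closed : IsClosedForm L φ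
  ind : ∀ a b : L.gr 0,
    φ (a : V) (R.pMap b : V) - φ ((L.bracket.flip (b : V) ^ (p - 1)) (a : V)) (b : V) = 0

/-- `(φ, θ) ∈ B²_*(L; K)`. -/
structure IsRestrictedCoboundary {p : ℕ} {L : LieSuperalgebra K V} (R : PTwoPStructure p L)
    (φ : LinearMap.BilinForm K V) (θ : L.gr 0 → K) : Prop extends
    IsRestrictedCochain p L φ θ where
  exists_primitive : ∃ χ : V →ₗ[K] K,
    (∀ a b : V, φ a b = χ (L.bracket a b)) ∧ ∀ a : L.gr 0, θ a = χ (R.pMap a : V)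

/-- `D` is an even derivation of `L`. -/
structure IsEvenDerivation (L : LieSuperalgebra K V) (D : Module.End K V) : Prop where
  even : ∀ i : ZMod 2, ∀ a ∈ L.gr i, D a ∈ L.gr i
  leibniz : ∀ a b : V, D (L.bracket a b) = L.bracket (D a) b + L.bracket a (D b)

/-- `D` is an even restricted derivation. -/
structure IsEvenRestrictedDerivation {p : ℕ} {L : LieSuperalgebra K V} (R : PTwoPStructure p L)
    (D : Module.End K V) : Prop extends IsEvenDerivation L D where
  map_pMap : ∀ a : L.gr 0,
    D (R.pMap a : V) = (L.bracket (a : V) ^ (p - 1)) (D (a : V))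

/-- The `p`-property of `D`, with witnesses `γ` and `a₀`. -/
structure IsPPropertyWitness (p : ℕ) (L : LieSuperalgebra K V) (D : Module.End K V)
    (γ : K) (a₀ : V) : Prop where
  mem : a₀ ∈ L.gr 0
  pow_eq : D ^ p = γ • D + L.bracket a₀
  map_eq : D a₀ = 0

/-- The centre of `L`. -/
def LieSuperalgebra.center (L : LieSuperalgebra K V) : Set V :=
  {b | ∀ a : V, L.bracket b a = 0}

end Restricted

section Adjoint

variable {K V : Type*} [Field K] [AddCommGroup V] [Module K V] [FiniteDimensional K V]

/-- The adjoint `D*` of an even linear map with respect to a non-degenerate form,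
`ω (D a) b = ω a (D* b)` (see `apply_formAdjoint`). -/
noncomputable def formAdjoint (ω : LinearMap.BilinForm K V) (hω : ω.Nondegenerate)
    (D : Module.End K V) : Module.End K V :=
  LinearMap.BilinForm.leftAdjointOfNondegenerate ω.flip hω.flip D

theorem apply_formAdjoint (ω : LinearMap.BilinForm K V) (hω : ω.Nondegenerate)
    (D : Module.End K V) (a b : V) : ω (D a) b = ω a (formAdjoint ω hω D b) :=
  (LinearMap.BilinForm.isAdjointPairLeftAdjointOfNondegenerate ω.flip hω.flip D b a).symm

/-- `C(a,b) = ω((D + D*)(a), b)`; here `Ds` stands for `D*`. -/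
def formC (ω : LinearMap.BilinForm K V) (D Ds : Module.End K V) : LinearMap.BilinForm K V :=
  LinearMap.comp ω (D + Ds)

/-- `Ω(a,b) = ω((D² + 2 D* D + D*² + lam (D + D*))(a), b)`. -/
def formOmega (ω : LinearMap.BilinForm K V) (D Ds : Module.End K V) (lam : K) :
    LinearMap.BilinForm K V :=
  LinearMap.comp ω (D * D + (2 : K) • (Ds * D) + Ds * Ds + lam • (D + Ds))

/-- `T(a) = ω((D + D*)(a), (ad_a)^{p-2}(D a)) + lam P(a)`. -/
def mapT (p : ℕ) (L : LieSuperalgebra K V) (ω : LinearMap.BilinForm K V)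
    (D Ds : Module.End K V) (lam : K) (P : L.gr 0 → K) (a : L.gr 0) : K :=
  ω ((D + Ds) (a : V)) ((L.bracket (a : V) ^ (p - 2)) (D (a : V))) + lam * P a

/-- `Ω(a,b) = ω(Z,[a,b])` for all `a, b`, and `T(a) = ω(Z, a^{[p]})` for all even `a`,
with `Z` even. -/
structure IsZOmega {p : ℕ} {L : LieSuperalgebra K V} (R : PTwoPStructure p L)
    (ω : LinearMap.BilinForm K V) (D Ds : Module.End K V) (lam : K) (P : L.gr 0 → K)
    (Z : V) : Prop where
  mem : Z ∈ L.gr 0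
  omega_eq : ∀ a b : V, formOmega ω D Ds lam a b = ω Z (L.bracket a b)
  map_eq : ∀ a : L.gr 0, mapT p L ω D Ds lam P a = ω Z (R.pMap a : V)

end Adjoint

section Extension

variable {K V : Type*} [Field K] [AddCommGroup V] [Module K V]

/-- The vector `x` of `K x ⊕ V ⊕ K x*`. -/
def extX (K V : Type*) [Field K] [AddCommGroup V] : K × V × K := (1, 0, 0)

/-- The vector `x*` of `K x ⊕ V ⊕ K x*`. -/
def extXStar (K V : Type*) [Field K] [AddCommGroup V] : K × V × K := (0, 0, 1)

/-- The inclusion of `V` in `K x ⊕ V ⊕ K x*`. -/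
def extIncl (K : Type*) {V : Type*} [Field K] [AddCommGroup V] (a : V) : K × V × K := (0, a, 0)

/-- `G` is the Lie superalgebra on `K x ⊕ L ⊕ K x*`, with `x` and `x*` even, whose bracket is
`[x,x*] = lam x`, `[a,b] = [a,b]_L + C(a,b) x`, `[x*,a] = D a + ω(Z,a) x`, `[x,a] = 0`
(the brackets `[x,x]` and `[x*,x*]` vanish by skew-symmetry). -/
structure IsDoubleExtension (L : LieSuperalgebra K V) (ω : LinearMap.BilinForm K V)
    (D Ds : Module.End K V) (lam : K) (Z : V) (G : LieSuperalgebra K (K × V × K)) : Prop where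
  mem_gr_zero : ∀ v : K × V × K, v ∈ G.gr 0 ↔ v.2.1 ∈ L.gr 0
  mem_gr_one : ∀ v : K × V × K, v ∈ G.gr 1 ↔ v.1 = 0 ∧ v.2.1 ∈ L.gr 1 ∧ v.2.2 = 0
  bracket_x_xStar : G.bracket (extX K V) (extXStar K V) = lam • extX K V
  bracket_x_incl : ∀ a : V, G.bracket (extX K V) (extIncl K a) = 0
  bracket_incl : ∀ a b : V, G.bracket (extIncl K a) (extIncl K b) =
    extIncl K (L.bracket a b) + ω (D a + Ds a) b • extX K V
  bracket_xStar_incl : ∀ a : V, G.bracket (extXStar K V) (extIncl K a) =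
    extIncl K (D a) + ω Z a • extX K V

/-- `ωG` is the form on `K x ⊕ V ⊕ K x*` extending `ω`, with `V` orthogonal to `x` and `x*`,
`ωG(x*,x) = 1` and `ωG(x,x) = ωG(x*,x*) = 0`. -/
structure IsExtendedForm (ω : LinearMap.BilinForm K V)
    (ωG : LinearMap.BilinForm K (K × V × K)) : Prop where
  incl_incl : ∀ a b : V, ωG (extIncl K a) (extIncl K b) = ω a b
  incl_x : ∀ a : V, ωG (extIncl K a) (extX K V) = 0
  incl_xStar : ∀ a : V, ωG (extIncl K a) (extXStar K V) = 0
  xStar_x : ωG (extXStar K V) (extX K V) = 1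
  x_x : ωG (extX K V) (extX K V) = 0
  xStar_xStar : ωG (extXStar K V) (extXStar K V) = 0

/-- `a^{[p]} = a^{[p]_L} + P(a) x`, `(x*)^{[p]} = γ x* + a₀ + lamT x`,
`x^{[p]} = b₀ + σ x + δ x*`. -/
structure IsExtendedPMap {p : ℕ} {L : LieSuperalgebra K V} (R : PTwoPStructure p L)
    (P : L.gr 0 → K) (γ lamT σ δ : K) (a₀ b₀ : V) {G : LieSuperalgebra K (K × V × K)}
    (RG : PTwoPStructure p G) : Prop where
  incl : ∀ (a : L.gr 0) (u : G.gr 0), (u : K × V × K) = extIncl K (a : V) →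
    (RG.pMap u : K × V × K) = extIncl K (R.pMap a : V) + P a • extX K V
  xStar : ∀ u : G.gr 0, (u : K × V × K) = extXStar K V →
    (RG.pMap u : K × V × K) = γ • extXStar K V + extIncl K a₀ + lamT • extX K V
  x : ∀ u : G.gr 0, (u : K × V × K) = extX K V →
    (RG.pMap u : K × V × K) = extIncl K b₀ + σ • extX K V + δ • extXStar K V

end Extension

/-!
The Lie superalgebra structure and the form on `K x ⊕ V ⊕ K x*` are direct checks, once one knows
`C(a,b) = ω(D a, b) + ω(a, D b)`: the Jacobi identity on `V` is the closedness of `C`, the Jacobi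
identity for `x*, a, b` says `C(D a, b) + C(a, D b) + lam C(a,b) = ω(Z, [a,b])`, whose left-hand
side is `Ω(a,b)` (`formOmega_apply_eq`), and the closedness of the extended form at `x*, a, b` is
the formula for `C` itself.  The identity `[a,[a,a]] = 0` for odd `a` needs `C(a,[a,a]) = 0`, which
in characteristic `3` comes from `ω` and not from `C` (`formC_apply_bracket_self`).  The element
`Z` is the even part of the vector that represents a primitive of `(Ω, T)` with respect to `ω`.

The `p`-map is glued from `a ↦ a^{[p]} + P(a) x` on `V₀` and the `p`-semilinear maps on the lines
`K x` and `K x*` with the given values at `x` and `x*`.  Write `S(u,v) = ∑ s_i(u,v)`.  The glued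
map `u + w ↦ q(u) + q'(w) + S(u,w)` satisfies the sum rule of a `p`-map as soon as `S` is a
symmetric `2`-cocycle of the additive group (`sSum_comm`, `sSum_cocycle`, `IsPMapAlong.add`).  This
holds in every Lie algebra in characteristic `p > 2`, and is obtained here without the
Poincaré-Birkhoff-Witt theorem.  Jacobson's formula (`IsBracketRep.map_sum_sElem`) says that a
representation sends `S(u,v)` to `(u + v)^p - u^p - v^p`.  Applied to the semidirect product with a
derivation `d`, it gives `d S(u,v) = q(u + v) - q(u) - q(v)` with `q(m) = (ad_m)^{p-1}(d m)`
(`derivation_sSum`), so that `d` annihilates every defect of symmetry or of the cocycle identity.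
For the scalar extension `K[X] ⊗ M` and `d = d/dX`, with one variable multiplied by `X`, the defect
is a polynomial of degree less than `p` with zero derivative, hence constant, and it vanishes at
`X = 0`.

The rule `ad_{u^{[p]}} = (ad_u)^p` is inherited by glued maps, again by Jacobson's formula, so that
it has to be checked on `V₀`, at `x` and at `x*` only.  On `V₀` it amounts to the cocycle condition
on `(C, P)` together with `T(a) = ω(Z, a^{[p]})`, and at `x` and `x*` to equations on the
parameters that hold in each of the three cases (`exists_pTwoPStructure_extSuperalgebra`).  The sum
rule on `V₀` is the `*`-property of `P`: the coefficient of `x` in `S(a,b)` is the sum over words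
in that property (`sSum_extBracket_extIncl`).
-/

/-! ### Jacobson's formula in an associative algebra -/

section Jacobson

open Polynomial

theorem natCast_choose_prime_sub_one {K : Type*} [Field K] (p : ℕ) [Fact p.Prime] [CharP K p] :
    ∀ k : ℕ, k < p → (((p - 1).choose k : ℕ) : K) = (-1) ^ k := by
  have hp := (Fact.out : p.Prime)
  intro k
  induction k with
  | zero => simp
  | succ k ih =>
    intro hk
    have h1 : p.choose (k + 1) = (p - 1).choose k + (p - 1).choose (k + 1) := by
      conv_lhs => rw [← Nat.sub_add_cancel hp.one_le]
      exact Nat.choose_succ_succ _ _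
    have h2 : ((p.choose (k + 1) : ℕ) : K) = 0 :=
      (CharP.cast_eq_zero_iff K p _).2 (hp.dvd_choose_self (by omega) hk)
    rw [h1, Nat.cast_add, ih (by omega)] at h2
    rw [eq_neg_of_add_eq_zero_right h2, pow_succ]
    ring

theorem Commute.sub_pow_prime_sub_one {K R : Type*} [Field K] [Ring R] [Algebra K R]
    {p : ℕ} [Fact p.Prime] [CharP K p] (hp : 2 < p) {x y : R} (h : Commute x y) :
    (x - y) ^ (p - 1) = ∑ k ∈ Finset.range p, x ^ k * y ^ (p - 1 - k) := by
  have hpp := (Fact.out : p.Prime)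
  have hodd : Odd p := hpp.odd_of_ne_two (by omega)
  rw [sub_eq_add_neg, h.neg_right.add_pow, Nat.sub_add_cancel hpp.one_le]
  refine Finset.sum_congr rfl fun k hk => ?_
  have hk' := Finset.mem_range.1 hk
  have hc : (((p - 1).choose k : ℕ) : R) = (-1) ^ k := by
    have := congrArg (algebraMap K R) (natCast_choose_prime_sub_one (K := K) p k hk')
    simpa using this
  have hs : (-1 : R) ^ (p - 1 - k) * (-1) ^ k = 1 := by
    rw [← pow_add, Nat.sub_add_cancel (by omega)]
    exact (Nat.Odd.sub_odd hodd odd_one).neg_one_pow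
  rw [hc, neg_pow, mul_assoc, mul_assoc, ← ((Commute.neg_one_left (y ^ (p - 1 - k))).pow_left k).eq,
    ← mul_assoc ((-1 : R) ^ (p - 1 - k)), hs, one_mul]

variable {K A M : Type*} [Field K] [Ring A] [Algebra K A] [AddCommGroup M] [Module K M]

theorem derivative_pow_eq_sum (g : A[X]) (n : ℕ) :
    derivative (g ^ (n + 1)) =
      ∑ k ∈ Finset.range (n + 1), g ^ k * derivative g * g ^ (n - k) := by
  induction n with
  | zero => simp
  | succ n ih =>
    rw [pow_succ', derivative_mul, ih, Finset.sum_range_succ' _ (n + 1), Finset.mul_sum, add_comm]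
    congr 1
    · refine Finset.sum_congr rfl fun k _ => ?_
      rw [Nat.add_sub_add_right, pow_succ']
      simp only [mul_assoc]
    · simp

/-- The inner derivation `h ↦ g h - h g` of an associative algebra. -/
def commutatorEnd (K : Type*) {R : Type*} [Field K] [Ring R] [Algebra K R] (g : R) :
    Module.End K R :=
  LinearMap.mulLeft K g - LinearMap.mulRight K g

/-- In characteristic `p`, the derivative of a `p`-th power is an iterated commutator. -/
theorem derivative_pow_prime {p : ℕ} [Fact p.Prime] [CharP K p] (hp : 2 < p) (g : A[X]) :
    derivative (g ^ p) =
      (commutatorEnd K g ^ (p - 1)) (derivative g) := by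
  have hpp := (Fact.out : p.Prime)
  rw [commutatorEnd, (LinearMap.commute_mulLeft_right (R := K) g g).sub_pow_prime_sub_one (K := K) hp]
  conv_lhs => rw [← Nat.sub_add_cancel hpp.one_le, derivative_pow_eq_sum,
    Nat.sub_add_cancel hpp.one_le]
  rw [LinearMap.sum_apply]
  refine Finset.sum_congr rfl fun k _ => ?_
  simp [Module.End.mul_apply, LinearMap.pow_mulLeft, LinearMap.pow_mulRight, mul_assoc]

theorem coeff_linear_pow (α β : A) (n j : ℕ) :
    ((C α * X + C β) ^ n).coeff j = adCoeff (LinearMap.mul K A) α β 1 n j := by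
  induction n generalizing j with
  | zero =>
    cases j with
    | zero => simp [adCoeff]
    | succ j => simp [adCoeff, coeff_one]
  | succ n ih =>
    rw [pow_succ', add_mul, coeff_add, mul_assoc, coeff_C_mul, coeff_C_mul]
    cases j with
    | zero => simp [adCoeff, ih]
    | succ j => rw [coeff_X_mul, ih, ih]; simp [adCoeff]

theorem adCoeff_zero_eq_pow (B : M →ₗ[K] M →ₗ[K] M) (a b c : M) (n : ℕ) :
    adCoeff B a b c n 0 = (B b ^ n) c := by
  induction n with
  | zero => simp [adCoeff]
  | succ n ih => rw [pow_succ', Module.End.mul_apply, ← ih]; simp [adCoeff]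

theorem adCoeff_self_eq_pow (B : M →ₗ[K] M →ₗ[K] M) (a b c : M) (n : ℕ) :
    adCoeff B a b c n n = (B a ^ n) c := by
  induction n with
  | zero => simp [adCoeff]
  | succ n ih =>
    rw [pow_succ', Module.End.mul_apply, ← ih]
    simp [adCoeff, adCoeff_eq_zero B a b c n (n + 1) (by omega)]

/-- The compatibility with brackets of a linear map from a (not necessarily associative) algebra
to an associative algebra, which is viewed as a Lie algebra through its commutator. -/
def IsBracketRep (B : M →ₗ[K] M →ₗ[K] M) (ρ : M →ₗ[K] A) : Prop :=
  ∀ a b : M, ρ (B a b) = ρ a * ρ b - ρ b * ρ a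

theorem IsBracketRep.coeff_pow_commutator {B : M →ₗ[K] M →ₗ[K] M} {ρ : M →ₗ[K] A}
    (h : IsBracketRep B ρ) (a b c : M) (n j : ℕ) :
    ((commutatorEnd K (C (ρ a) * X + C (ρ b)) ^ n) (C (ρ c))).coeff j =
      ρ (adCoeff B a b c n j) := by
  induction n generalizing j with
  | zero =>
    cases j with
    | zero => simp [adCoeff]
    | succ j => simp [adCoeff]
  | succ n ih =>
    rw [pow_succ', Module.End.mul_apply]
    set q := (commutatorEnd K (C (ρ a) * X + C (ρ b)) ^ n) (C (ρ c)) with hq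
    have e : commutatorEnd K (C (ρ a) * X + C (ρ b)) q =
        C (ρ a) * (X * q) + C (ρ b) * q - (q * C (ρ a) * X + q * C (ρ b)) := by
      simp [commutatorEnd, add_mul, mul_add, mul_assoc]
    rw [e, coeff_sub, coeff_add, coeff_add, coeff_C_mul, coeff_C_mul, coeff_mul_C]
    cases j with
    | zero => simp [adCoeff, ih, h b]
    | succ j =>
      rw [coeff_X_mul, coeff_mul_X, coeff_mul_C, ih, ih]
      simp only [adCoeff, map_add, h a, h b]
      abel

/-- **Jacobson's formula**: a representation carries `∑ s_i(a,b)` to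
`(a + b)^p - a^p - b^p`. -/
theorem IsBracketRep.map_sum_sElem {B : M →ₗ[K] M →ₗ[K] M} {ρ : M →ₗ[K] A}
    (h : IsBracketRep B ρ) {p : ℕ} [Fact p.Prime] [CharP K p] (hp : 2 < p) (a b : M) :
    ρ (∑ i ∈ Finset.Icc 1 (p - 1), sElem p B a b i) =
      (ρ a + ρ b) ^ p - ρ a ^ p - ρ b ^ p := by
  have hc : ∀ i ∈ Finset.Icc 1 (p - 1),
      ρ (sElem p B a b i) = adCoeff (LinearMap.mul K A) (ρ a) (ρ b) 1 p i := by
    intro i hi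
    obtain ⟨hi1, hi2⟩ := Finset.mem_Icc.1 hi
    have hne : (i : K) ≠ 0 := by
      rw [Ne, CharP.cast_eq_zero_iff K p]
      exact fun hd => absurd (Nat.le_of_dvd (by omega) hd) (by omega)
    have h1 := congrArg (fun q => q.coeff (i - 1))
      (derivative_pow_prime (K := K) hp (C (ρ a) * X + C (ρ b)))
    have h2 : derivative (C (ρ a) * X + C (ρ b)) = C (ρ a) := by simp
    simp only [h2] at h1
    rw [h.coeff_pow_commutator, coeff_derivative, coeff_linear_pow (K := K),
      Nat.sub_add_cancel hi1] at h1
    rw [sElem, map_smul, ← h1]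
    have h3 : (((i - 1 : ℕ) : A) + 1) = algebraMap K A (i : K) := by
      rw [map_natCast, ← Nat.cast_succ, Nat.succ_eq_add_one, Nat.sub_add_cancel hi1]
    rw [h3, ← Algebra.commutes, ← Algebra.smul_def, smul_smul, inv_mul_cancel₀ hne, one_smul]
  have h4 := pow_ad_eq_sum_adCoeff (LinearMap.mul K A) (ρ a) (ρ b) 1 1 p
  have h5 : ∀ x : A, ((LinearMap.mul K A) x ^ p) 1 = x ^ p := by
    intro x
    change (LinearMap.mulLeft K x ^ p) 1 = _
    rw [LinearMap.pow_mulLeft]; simp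
  rw [one_smul, h5, Finset.sum_range_succ, Finset.range_eq_Ico,
    Finset.sum_eq_sum_Ico_succ_bot (by omega), adCoeff_zero_eq_pow, adCoeff_self_eq_pow,
    h5, h5] at h4
  have h6 : Finset.Ico (0 + 1) p = Finset.Icc 1 (p - 1) := by ext; simp; omega
  simp only [one_pow, one_smul, h6] at h4
  rw [map_sum, Finset.sum_congr rfl hc, h4]
  abel

end Jacobson

/-! ### The correction term of a `p`-map -/

section SSum

variable {K M N : Type*} [Field K] [AddCommGroup M] [Module K M] [AddCommGroup N] [Module K N]

/-- A skew-symmetric bracket that satisfies the Jacobi identity. -/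
structure IsLieBracket (B : M →ₗ[K] M →ₗ[K] M) : Prop where
  skew : ∀ a b : M, B a b = -B b a
  jacobi : ∀ a b c : M, B a (B b c) = B (B a b) c + B b (B a c)

/-- The correction term `∑ s_i(a,b)`, over `1 ≤ i ≤ p - 1`, in the sum rule of a `p`-map. -/
def sSum (p : ℕ) (B : M →ₗ[K] M →ₗ[K] M) (a b : M) : M :=
  ∑ i ∈ Finset.Icc 1 (p - 1), sElem p B a b i

theorem map_adCoeff {B : M →ₗ[K] M →ₗ[K] M} {B' : N →ₗ[K] N →ₗ[K] N} (f : M →ₗ[K] N)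
    (hf : ∀ a b, f (B a b) = B' (f a) (f b)) (a b c : M) (n j : ℕ) :
    f (adCoeff B a b c n j) = adCoeff B' (f a) (f b) (f c) n j := by
  induction n generalizing j with
  | zero => cases j <;> simp [adCoeff]
  | succ n ih => cases j <;> simp [adCoeff, hf, ih]

theorem map_sSum {B : M →ₗ[K] M →ₗ[K] M} {B' : N →ₗ[K] N →ₗ[K] N} (f : M →ₗ[K] N)
    (hf : ∀ a b, f (B a b) = B' (f a) (f b)) (p : ℕ) (a b : M) :
    f (sSum p B a b) = sSum p B' (f a) (f b) := by
  simp only [sSum, sElem, map_sum, map_smul, map_adCoeff f hf]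

theorem adCoeff_eq_zero_of_bracket_eq_zero (B : M →ₗ[K] M →ₗ[K] M) {a b c : M}
    (ha : B a c = 0) (hb : B b c = 0) (n j : ℕ) : adCoeff B a b c (n + 1) j = 0 := by
  induction n generalizing j with
  | zero =>
    cases j with
    | zero => simp [adCoeff, hb]
    | succ j => cases j <;> simp [adCoeff, ha]
  | succ n ih => cases j <;> rw [adCoeff] <;> simp [ih]

theorem sSum_eq_zero (B : M →ₗ[K] M →ₗ[K] M) {p : ℕ} (hp : 2 < p) {a b : M}
    (ha : B a a = 0) (hb : B b a = 0) : sSum p B a b = 0 := by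
  obtain ⟨n, hn⟩ : ∃ n, p - 1 = n + 1 := ⟨p - 2, by omega⟩
  refine Finset.sum_eq_zero fun i _ => ?_
  rw [sElem, hn, adCoeff_eq_zero_of_bracket_eq_zero B ha hb, smul_zero]

theorem sSum_zero_left {p : ℕ} (B : M →ₗ[K] M →ₗ[K] M) (hp : 2 < p) (b : M) : sSum p B 0 b = 0 :=
  sSum_eq_zero B hp (by simp) (by simp)

theorem IsLieBracket.apply_self {p : ℕ} [CharP K p] {B : M →ₗ[K] M →ₗ[K] M}
    (hB : IsLieBracket B) (hp : 2 < p) (a : M) : B a a = 0 := by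
  have h2 : (2 : K) ≠ 0 := by
    have h := CharP.cast_eq_zero_iff K p 2
    rw [Nat.cast_ofNat] at h
    exact fun h0 => absurd (Nat.le_of_dvd (by omega) (h.1 h0)) (by omega)
  have h := hB.skew a a
  rw [eq_neg_iff_add_eq_zero, ← two_smul K] at h
  exact (smul_eq_zero.1 h).resolve_left h2

theorem sSum_zero_right {p : ℕ} [CharP K p] {B : M →ₗ[K] M →ₗ[K] M}
    (hB : IsLieBracket B) (hp : 2 < p) (a : M) :
    sSum p B a 0 = 0 :=
  sSum_eq_zero B hp (hB.apply_self hp a) (by simp)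

theorem adCoeff_smul (B : M →ₗ[K] M →ₗ[K] M) (r : K) (a b c : M) (n j : ℕ) :
    adCoeff B (r • a) (r • b) (r • c) n j = r ^ (n + 1) • adCoeff B a b c n j := by
  induction n generalizing j with
  | zero => cases j <;> simp [adCoeff]
  | succ n ih => cases j <;> simp [adCoeff, ih, smul_smul, smul_add, pow_succ, mul_comm]

theorem sSum_smul (B : M →ₗ[K] M →ₗ[K] M) {p : ℕ} (hp : 2 < p) (r : K) (a b : M) :
    sSum p B (r • a) (r • b) = r ^ p • sSum p B a b := by
  rw [sSum, sSum, Finset.smul_sum]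
  refine Finset.sum_congr rfl fun i _ => ?_
  rw [sElem, sElem, adCoeff_smul, smul_comm, Nat.sub_add_cancel (by omega)]

/-- The representation of `M` on `M ⊕ K` attached to a derivation `d`: the adjoint action on the
ideal `M` of the semidirect product `M ⋊ K d`. -/
def semidirectRep (B : M →ₗ[K] M →ₗ[K] M) (d : Module.End K M) : M →ₗ[K] Module.End K (M × K) :=
  LinearMap.mk₂ K (fun m z => (B m z.1 - z.2 • d m, (0 : K)))
    (by intros; ext <;> simp [smul_add]; abel)
    (by intro r m z; ext <;> simp [smul_sub, smul_comm z.2 r])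
    (by intros; ext <;> simp [add_smul]; abel)
    (by intros; ext <;> simp [smul_sub, smul_smul])

theorem semidirectRep_apply (B : M →ₗ[K] M →ₗ[K] M) (d : Module.End K M) (m : M) (z : M × K) :
    semidirectRep B d m z = (B m z.1 - z.2 • d m, 0) := rfl

theorem isBracketRep_semidirectRep {B : M →ₗ[K] M →ₗ[K] M} (hB : IsLieBracket B)
    {d : Module.End K M} (hd : ∀ a b, d (B a b) = B (d a) b + B a (d b)) :
    IsBracketRep B (semidirectRep B d) := by
  intro a b
  refine LinearMap.ext fun z => ?_
  simp only [LinearMap.sub_apply, Module.End.mul_apply, semidirectRep_apply]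
  ext
  · simp only [map_sub, map_smul, zero_smul, sub_zero, Prod.fst_sub, hd, hB.jacobi a b z.1,
      hB.skew (d a) b, smul_add, smul_neg]
    abel
  · simp

theorem semidirectRep_pow_apply (B : M →ₗ[K] M →ₗ[K] M) (d : Module.End K M) (m : M) (n : ℕ) :
    (semidirectRep B d m ^ (n + 1)) (0, -1) = ((B m ^ n) (d m), 0) := by
  induction n with
  | zero => simp [semidirectRep_apply]
  | succ n ih =>
    rw [pow_succ', Module.End.mul_apply, ih, semidirectRep_apply]
    simp [pow_succ', Module.End.mul_apply]

/-- A derivation `d` satisfies `d(∑ s_i(a,b)) = q(a + b) - q(a) - q(b)`,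
where `q(m) = (ad_m)^{p-1}(d m)`. -/
theorem derivation_sSum {p : ℕ} [Fact p.Prime] [CharP K p] (hp : 2 < p)
    {B : M →ₗ[K] M →ₗ[K] M} (hB : IsLieBracket B)
    {d : Module.End K M} (hd : ∀ a b, d (B a b) = B (d a) b + B a (d b)) (a b : M) :
    d (sSum p B a b) = (B (a + b) ^ (p - 1)) (d (a + b)) - (B a ^ (p - 1)) (d a)
      - (B b ^ (p - 1)) (d b) := by
  have h := congrArg (fun f : Module.End K (M × K) => (f (0, -1)).1)
    ((isBracketRep_semidirectRep hB hd).map_sum_sElem hp a b)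
  obtain ⟨n, rfl⟩ : ∃ n, p = n + 1 := ⟨p - 1, by omega⟩
  simp only [← map_add, LinearMap.sub_apply, semidirectRep_pow_apply] at h
  simpa [semidirectRep_apply, sSum, Prod.fst_sum] using h

end SSum

/-! ### Scalar extension to polynomials -/

section PolynomialExtension

open Polynomial TensorProduct

variable {K M : Type*} [Field K] [AddCommGroup M] [Module K M]

/-- The bracket on `K[X] ⊗ M` that is `K[X]`-bilinear and extends `B`. -/
noncomputable def polyBracket (B : M →ₗ[K] M →ₗ[K] M) :
    (K[X] ⊗[K] M) →ₗ[K] (K[X] ⊗[K] M) →ₗ[K] (K[X] ⊗[K] M) :=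
  TensorProduct.map₂ (LinearMap.mul K K[X]) B

@[simp]
theorem polyBracket_tmul (B : M →ₗ[K] M →ₗ[K] M) (f g : K[X]) (a b : M) :
    polyBracket B (f ⊗ₜ a) (g ⊗ₜ b) = (f * g) ⊗ₜ B a b := by
  simp [polyBracket]

theorem IsLieBracket.polyBracket {B : M →ₗ[K] M →ₗ[K] M} (hB : IsLieBracket B) :
    IsLieBracket (polyBracket B) where
  skew x y := by
    induction x with
    | zero => simp
    | add x x' hx hx' => simp only [map_add, LinearMap.add_apply, hx, hx', neg_add]
    | tmul f a =>
      induction y with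
      | zero => simp
      | add y y' hy hy' => simp only [map_add, LinearMap.add_apply, hy, hy', neg_add]
      | tmul g b => simp [hB.skew a b, mul_comm f g, tmul_neg]
  jacobi x y z := by
    induction x with
    | zero => simp
    | add x x' hx hx' => simp only [map_add, LinearMap.add_apply, hx, hx']; abel
    | tmul f a =>
      induction y with
      | zero => simp
      | add y y' hy hy' => simp only [map_add, LinearMap.add_apply, hy, hy']; abel
      | tmul g b =>
        induction z with
        | zero => simp
        | add z z' hz hz' => simp only [map_add, hz, hz']; abel
        | tmul h c =>
          simp only [polyBracket_tmul, hB.jacobi a b c, tmul_add, mul_assoc, mul_left_comm f g h]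

/-- The derivation `d/dX` of `K[X] ⊗ M`. -/
noncomputable def polyDerivative (K M : Type*) [Field K] [AddCommGroup M] [Module K M] :
    Module.End K (K[X] ⊗[K] M) :=
  (Polynomial.derivative : K[X] →ₗ[K] K[X]).rTensor M

theorem polyDerivative_polyBracket (B : M →ₗ[K] M →ₗ[K] M) (x y : K[X] ⊗[K] M) :
    polyDerivative K M (polyBracket B x y) =
      polyBracket B (polyDerivative K M x) y + polyBracket B x (polyDerivative K M y) := by
  induction x with
  | zero => simp
  | add x x' hx hx' => simp only [map_add, LinearMap.add_apply, hx, hx']; abel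
  | tmul f a =>
    induction y with
    | zero => simp
    | add y y' hy hy' => simp only [map_add, hy, hy']; abel
    | tmul g b => simp [polyDerivative, add_tmul]

/-- Evaluation of the elements of `K[X] ⊗ M` at a scalar. -/
noncomputable def polyEval (M : Type*) {K : Type*} [Field K] [AddCommGroup M] [Module K M] (r : K) :
    (K[X] ⊗[K] M) →ₗ[K] M :=
  TensorProduct.lid K M ∘ₗ (Polynomial.leval r).rTensor M

@[simp]
theorem polyEval_tmul (r : K) (f : K[X]) (a : M) : polyEval M r (f ⊗ₜ a) = f.eval r • a := by
  simp [polyEval]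

theorem polyEval_polyBracket (B : M →ₗ[K] M →ₗ[K] M) (r : K) (x y : K[X] ⊗[K] M) :
    polyEval M r (polyBracket B x y) = B (polyEval M r x) (polyEval M r y) := by
  induction x with
  | zero => simp
  | add x x' hx hx' => simp only [map_add, LinearMap.add_apply, hx, hx']
  | tmul f a =>
    induction y with
    | zero => simp
    | add y y' hy hy' => simp only [map_add, hy, hy']
    | tmul g b => simp [smul_smul, mul_comm]

/-- The `n`-th coefficient of the elements of `K[X] ⊗ M`. -/
noncomputable def polyCoeff (K M : Type*) [Field K] [AddCommGroup M] [Module K M] (n : ℕ) :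
    (K[X] ⊗[K] M) →ₗ[K] M :=
  TensorProduct.lid K M ∘ₗ (Polynomial.lcoeff K n).rTensor M

@[simp]
theorem polyCoeff_tmul (n : ℕ) (f : K[X]) (a : M) :
    polyCoeff K M n (f ⊗ₜ a) = f.coeff n • a := by
  simp [polyCoeff]

theorem polyCoeff_polyDerivative (n : ℕ) (x : K[X] ⊗[K] M) :
    polyCoeff K M n (polyDerivative K M x) = ((n + 1 : ℕ) : K) • polyCoeff K M (n + 1) x := by
  induction x with
  | zero => simp
  | add x x' hx hx' => simp only [map_add, hx, hx', smul_add]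
  | tmul f a => simp [polyDerivative, coeff_derivative, smul_smul, mul_comm]

/-- The elements of `K[X] ⊗ M` of degree at most `d`. -/
noncomputable def polyDegreeLE (K M : Type*) [Field K] [AddCommGroup M] [Module K M] (d : ℕ) :
    Submodule K (K[X] ⊗[K] M) :=
  Submodule.span K {x | ∃ k ≤ d, ∃ a : M, x = (X ^ k : K[X]) ⊗ₜ a}

theorem X_pow_tmul_mem_polyDegreeLE {k d : ℕ} (h : k ≤ d) (a : M) :
    (X ^ k : K[X]) ⊗ₜ[K] a ∈ polyDegreeLE K M d :=
  Submodule.subset_span ⟨k, h, a, rfl⟩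

theorem one_tmul_mem_polyDegreeLE (d : ℕ) (a : M) :
    (1 : K[X]) ⊗ₜ[K] a ∈ polyDegreeLE K M d := by
  simpa using X_pow_tmul_mem_polyDegreeLE (K := K) (Nat.zero_le d) a

theorem polyDegreeLE_mono {d e : ℕ} (h : d ≤ e) : polyDegreeLE K M d ≤ polyDegreeLE K M e :=
  Submodule.span_mono fun _ ⟨k, hk, a, ha⟩ => ⟨k, hk.trans h, a, ha⟩

theorem polyBracket_mem_polyDegreeLE (B : M →ₗ[K] M →ₗ[K] M) {d e : ℕ} {x y : K[X] ⊗[K] M}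
    (hx : x ∈ polyDegreeLE K M d) (hy : y ∈ polyDegreeLE K M e) :
    polyBracket B x y ∈ polyDegreeLE K M (d + e) := by
  have h := Submodule.apply_mem_map₂ (polyBracket B) hx hy
  rw [polyDegreeLE, polyDegreeLE, Submodule.map₂_span_span] at h
  refine Submodule.span_mono ?_ h
  rintro _ ⟨_, ⟨k, hk, a, rfl⟩, _, ⟨l, hl, b, rfl⟩, rfl⟩
  exact ⟨k + l, add_le_add hk hl, B a b, by simp [pow_add]⟩

theorem polyEval_eq_sum_polyCoeff {d : ℕ} (r : K) {x : K[X] ⊗[K] M}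
    (hx : x ∈ polyDegreeLE K M d) :
    polyEval M r x = ∑ n ∈ Finset.range (d + 1), r ^ n • polyCoeff K M n x := by
  have : polyDegreeLE K M d ≤ LinearMap.eqLocus (polyEval M r)
      (∑ n ∈ Finset.range (d + 1), r ^ n • polyCoeff K M n) := by
    refine Submodule.span_le.2 ?_
    rintro _ ⟨k, hk, a, rfl⟩
    simp [LinearMap.sum_apply, coeff_X_pow, ite_smul, Nat.lt_succ_of_le hk]
  simpa [LinearMap.sum_apply] using this hx

/-- A polynomial of degree less than `p` with vanishing derivative is constant in
characteristic `p`. -/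
theorem polyEval_eq_of_polyDerivative_eq_zero {p : ℕ} [CharP K p]
    {x : K[X] ⊗[K] M} {d : ℕ} (hd : d < p) (hx : x ∈ polyDegreeLE K M d)
    (h : polyDerivative K M x = 0) (r s : K) : polyEval M r x = polyEval M s x := by
  have hc : ∀ n, n ∈ Finset.range d → polyCoeff K M (n + 1) x = 0 := by
    intro n hn
    have h1 := polyCoeff_polyDerivative n x
    rw [h, map_zero] at h1
    refine (smul_eq_zero.1 h1.symm).resolve_left ?_
    rw [CharP.cast_eq_zero_iff K p]
    have := Finset.mem_range.1 hn
    exact fun hdvd => absurd (Nat.le_of_dvd (by omega) hdvd) (by omega)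
  have e : ∀ t : K, polyEval M t x = polyCoeff K M 0 x := by
    intro t
    rw [polyEval_eq_sum_polyCoeff t hx, Finset.sum_range_succ',
      Finset.sum_eq_zero fun n hn => by rw [hc n hn, smul_zero]]
    simp
  rw [e, e]

theorem adCoeff_mem_polyDegreeLE (B : M →ₗ[K] M →ₗ[K] M) {x y z : K[X] ⊗[K] M} {k l m : ℕ}
    (hx : x ∈ polyDegreeLE K M k) (hy : y ∈ polyDegreeLE K M l) (hz : z ∈ polyDegreeLE K M m)
    (n j : ℕ) : adCoeff (polyBracket B) x y z n j ∈ polyDegreeLE K M (j * k + (n - j) * l + m) := by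
  induction n generalizing j with
  | zero =>
    cases j with
    | zero => simpa [adCoeff] using hz
    | succ j => simp [adCoeff]
  | succ n ih =>
    cases j with
    | zero =>
      simp only [adCoeff]
      refine polyDegreeLE_mono ?_ (polyBracket_mem_polyDegreeLE B hy (ih 0))
      simp only [Nat.sub_zero]; apply le_of_eq; ring
    | succ j =>
      rcases lt_or_ge (n + 1) (j + 1) with hj | hj
      · rw [adCoeff_eq_zero _ _ _ _ _ _ hj]; exact Submodule.zero_mem _
      simp only [adCoeff]
      refine Submodule.add_mem _ ?_ ?_
      · refine polyDegreeLE_mono ?_ (polyBracket_mem_polyDegreeLE B hx (ih j))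
        rw [Nat.add_sub_add_right]; apply le_of_eq; ring
      · rcases Nat.lt_or_ge n (j + 1) with hj' | hj'
        · rw [adCoeff_eq_zero _ _ _ _ _ _ hj', map_zero]; exact Submodule.zero_mem _
        refine polyDegreeLE_mono ?_ (polyBracket_mem_polyDegreeLE B hy (ih (j + 1)))
        obtain ⟨r, rfl⟩ := Nat.exists_eq_add_of_le hj'
        rw [show j + 1 + r - (j + 1) = r by omega, show j + 1 + r + 1 - (j + 1) = r + 1 by omega]
        apply le_of_eq; ring

theorem sSum_mem_polyDegreeLE_right (B : M →ₗ[K] M →ₗ[K] M) (p : ℕ) {x y : K[X] ⊗[K] M}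
    (hx : x ∈ polyDegreeLE K M 0) (hy : y ∈ polyDegreeLE K M 1) :
    sSum p (polyBracket B) x y ∈ polyDegreeLE K M (p - 1) := by
  refine Submodule.sum_mem _ fun i _ => Submodule.smul_mem _ _ ?_
  exact polyDegreeLE_mono (by omega) (adCoeff_mem_polyDegreeLE B hx hy hx _ _)

theorem sSum_mem_polyDegreeLE_left (B : M →ₗ[K] M →ₗ[K] M) (p : ℕ) {x y : K[X] ⊗[K] M}
    (hx : x ∈ polyDegreeLE K M 1) (hy : y ∈ polyDegreeLE K M 0) :
    sSum p (polyBracket B) x y ∈ polyDegreeLE K M (p - 1) := by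
  refine Submodule.sum_mem _ fun i hi => Submodule.smul_mem _ _ ?_
  have := Finset.mem_Icc.1 hi
  exact polyDegreeLE_mono (by omega) (adCoeff_mem_polyDegreeLE B hx hy hx _ _)

end PolynomialExtension

section Cocycle

open Polynomial TensorProduct

variable {K M : Type*} [Field K] [AddCommGroup M] [Module K M] {p : ℕ} [Fact p.Prime] [CharP K p]

/-- The correction term is symmetric. -/
theorem sSum_comm {B : M →ₗ[K] M →ₗ[K] M} (hB : IsLieBracket B) (hp : 2 < p) (a b : M) :
    sSum p B a b = sSum p B b a := by
  have key : ∀ r : K, polyEval M r (sSum p (polyBracket B) (1 ⊗ₜ a) ((X ^ 1) ⊗ₜ b)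
      - sSum p (polyBracket B) ((X ^ 1) ⊗ₜ b) (1 ⊗ₜ a)) =
      sSum p B a (r • b) - sSum p B (r • b) a := by
    intro r
    simp only [map_sub, map_sSum _ (polyEval_polyBracket B r)]
    simp
  have h := polyEval_eq_of_polyDerivative_eq_zero (p := p) (d := p - 1) (by omega)
    (Submodule.sub_mem _
      (sSum_mem_polyDegreeLE_right B p (one_tmul_mem_polyDegreeLE 0 a)
        (X_pow_tmul_mem_polyDegreeLE le_rfl b))
      (sSum_mem_polyDegreeLE_left B p (X_pow_tmul_mem_polyDegreeLE le_rfl b)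
        (one_tmul_mem_polyDegreeLE 0 a))) (by
      simp only [map_sub, derivation_sSum hp hB.polyBracket (polyDerivative_polyBracket B)]
      rw [add_comm ((X ^ 1 : K[X]) ⊗ₜ[K] b)]
      abel) 1 0
  rw [key, key] at h
  simpa [sub_eq_zero, sSum_zero_left B hp, sSum_zero_right hB hp] using h

/-- The correction term is a `2`-cocycle of the additive group.  For `w` replaced by `X w` the
two sides become polynomials of degree less than `p` with the same derivative, since the derivative
of the correction term is a coboundary by `derivation_sSum`. -/
theorem sSum_cocycle {B : M →ₗ[K] M →ₗ[K] M} (hB : IsLieBracket B) (hp : 2 < p) (u v w : M) :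
    sSum p B u v + sSum p B (u + v) w = sSum p B v w + sSum p B u (v + w) := by
  set U : K[X] ⊗[K] M := 1 ⊗ₜ u with hU
  set V : K[X] ⊗[K] M := 1 ⊗ₜ v with hV
  set W : K[X] ⊗[K] M := (X ^ 1) ⊗ₜ w with hW
  have mU : U ∈ polyDegreeLE K M 0 := one_tmul_mem_polyDegreeLE 0 u
  have mV : V ∈ polyDegreeLE K M 0 := one_tmul_mem_polyDegreeLE 0 v
  have mV' : V ∈ polyDegreeLE K M 1 := one_tmul_mem_polyDegreeLE 1 v
  have mW : W ∈ polyDegreeLE K M 1 := X_pow_tmul_mem_polyDegreeLE le_rfl w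
  have key : ∀ r : K, polyEval M r (sSum p (polyBracket B) U V
      + sSum p (polyBracket B) (U + V) W
      - (sSum p (polyBracket B) V W + sSum p (polyBracket B) U (V + W))) =
      sSum p B u v + sSum p B (u + v) (r • w)
        - (sSum p B v (r • w) + sSum p B u (v + r • w)) := by
    intro r
    simp only [map_sub, map_add, map_sSum _ (polyEval_polyBracket B r)]
    simp [hU, hV, hW]
  have h := polyEval_eq_of_polyDerivative_eq_zero (p := p) (d := p - 1) (by omega)
    (Submodule.sub_mem _
      (Submodule.add_mem _ (sSum_mem_polyDegreeLE_right B p mU mV')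
        (sSum_mem_polyDegreeLE_right B p (Submodule.add_mem _ mU mV) mW))
      (Submodule.add_mem _ (sSum_mem_polyDegreeLE_right B p mV mW)
        (sSum_mem_polyDegreeLE_right B p mU (Submodule.add_mem _ mV' mW)))) (by
      rw [map_sub, map_add, map_add]
      simp only [derivation_sSum hp hB.polyBracket (polyDerivative_polyBracket B), add_assoc]
      abel) 1 0
  rw [key, key] at h
  simpa [sub_eq_zero, sSum_zero_right hB hp] using h

/-- The four-term identity by which `p`-maps on two subspaces glue to one on their sum. -/
theorem sSum_add_add {B : M →ₗ[K] M →ₗ[K] M} (hB : IsLieBracket B) (hp : 2 < p) (u v w z : M) :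
    sSum p B u v + sSum p B w z + sSum p B (u + v) (w + z) =
      sSum p B u w + sSum p B v z + sSum p B (u + w) (v + z) := by
  have h1 := sSum_cocycle hB hp (u + v) w z
  have h2 := sSum_cocycle hB hp u v w
  have h3 := sSum_cocycle hB hp (u + w) v z
  have h4 := sSum_cocycle hB hp u w v
  rw [add_comm w v, sSum_comm hB hp w v] at h4
  rw [add_right_comm u w v] at h3
  have e1 : sSum p B w z + sSum p B (u + v) (w + z) =
    sSum p B (u + v) w + sSum p B (u + v + w) z := h1.symm
  have e2 : sSum p B u v + sSum p B (u + v) w = sSum p B u w + sSum p B (u + w) v := h2.trans h4.symm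
  rw [add_assoc, e1, ← add_assoc, e2, add_assoc, h3]
  abel

/-- The map `q : N → M` satisfies the rules of a `p`-map along the linear map `f : N → M`, that is,
with `f n` in place of `n` in the sum rule and in the rule for the representation `ρ`. -/
structure IsPMapAlong {N A : Type*} [AddCommGroup N] [Module K N] [Ring A] [Algebra K A] (p : ℕ)
    (B : M →ₗ[K] M →ₗ[K] M) (ρ : M →ₗ[K] A) (f : N →ₗ[K] M) (q : N → M) : Prop where
  smul_rule : ∀ (r : K) (n : N), q (r • n) = r ^ p • q n
  add_rule : ∀ m n : N, q (m + n) = q m + q n + sSum p B (f m) (f n)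
  rep_rule : ∀ n : N, ρ (q n) = ρ (f n) ^ p

variable {N A : Type*} [AddCommGroup N] [Module K N] [Ring A] [Algebra K A]

/-- Gluing of `p`-maps. -/
theorem IsPMapAlong.add {B : M →ₗ[K] M →ₗ[K] M} (hB : IsLieBracket B) (hp : 2 < p)
    {ρ : M →ₗ[K] A} (hρ : IsBracketRep B ρ) {f f' : N →ₗ[K] M} {q q' : N → M}
    (h : IsPMapAlong p B ρ f q) (h' : IsPMapAlong p B ρ f' q') :
    IsPMapAlong p B ρ (f + f') (fun n => q n + q' n + sSum p B (f n) (f' n)) where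
  smul_rule r n := by
    simp only [h.smul_rule, h'.smul_rule, map_smul, sSum_smul B hp, smul_add]
  add_rule m n := by
    have e := sSum_add_add hB hp (f m) (f n) (f' m) (f' n)
    simp only [h.add_rule, h'.add_rule, map_add, LinearMap.add_apply]
    rw [add_add_add_comm (q m + q n), add_assoc (q m + q n + (q' m + q' n)), e]
    abel
  rep_rule n := by
    simp only [map_add, h.rep_rule, h'.rep_rule, LinearMap.add_apply]
    rw [sSum, hρ.map_sum_sElem hp]
    abel

/-- A `p`-map on a line is given by the image of a generator. -/
theorem isPMapAlong_line {B : M →ₗ[K] M →ₗ[K] M} (hB : IsLieBracket B) (hp : 2 < p)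
    {ρ : M →ₗ[K] A} (l : N →ₗ[K] K) {e y : M} (h : ρ y = ρ e ^ p) :
    IsPMapAlong p B ρ (l.smulRight e) (fun n => l n ^ p • y) where
  smul_rule r n := by simp [mul_pow, smul_smul]
  add_rule m n := by
    have he := hB.apply_self hp e
    rw [sSum_eq_zero B hp (by simp [he]) (by simp [he])]
    simp [add_pow_char, add_smul]
  rep_rule n := by simp [h, _root_.smul_pow]

end Cocycle

/-! ### Super forms and derivations -/

section SuperForms

variable {K V : Type*} [Field K] [AddCommGroup V] [Module K V]

@[simp]
theorem superSign_zero_left (i : ZMod 2) : superSign K 0 i = 1 := by simp [superSign]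

@[simp]
theorem superSign_zero_right (i : ZMod 2) : superSign K i 0 = 1 := by simp [superSign]

@[simp]
theorem superSign_one_one : superSign K 1 1 = -1 := by simp [superSign]

theorem parity_cases (i : ZMod 2) : i = 0 ∨ i = 1 := by
  revert i; decide

theorem one_add_one_parity : (1 + 1 : ZMod 2) = 0 := by decide

theorem LieSuperalgebra.exists_add (L : LieSuperalgebra K V) (v : V) :
    ∃ a ∈ L.gr 0, ∃ b ∈ L.gr 1, a + b = v :=
  Submodule.mem_sup.1 (L.isCompl.sup_eq_top ▸ Submodule.mem_top)

/-- On even elements the bracket is an ordinary Lie bracket, and it acts on all of `V`. -/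
theorem LieSuperalgebra.jacobi_even (L : LieSuperalgebra K V) {a b : V} (ha : a ∈ L.gr 0)
    (hb : b ∈ L.gr 0) (c : V) :
    L.bracket a (L.bracket b c) = L.bracket (L.bracket a b) c + L.bracket b (L.bracket a c) := by
  obtain ⟨c₀, h₀, c₁, h₁, rfl⟩ := L.exists_add c
  have e₀ := L.jacobi 0 0 0 a ha b hb c₀ h₀
  have e₁ := L.jacobi 0 0 1 a ha b hb c₁ h₁
  simp only [superSign_zero_left, one_smul] at e₀ e₁
  simp only [map_add, e₀, e₁]
  abel

theorem IsSuperAntisymmetric.apply_eq {L : LieSuperalgebra K V} {φ : LinearMap.BilinForm K V}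
    (h : IsSuperAntisymmetric L φ) (he : IsEvenForm L φ) {i : ZMod 2} {b : V} (hb : b ∈ L.gr i)
    (v : V) : φ v b = -(superSign K i i * φ b v) := by
  obtain ⟨a₀, h₀, a₁, h₁, rfl⟩ := L.exists_add v
  rcases parity_cases i with rfl | rfl
  · simp only [map_add, LinearMap.add_apply, h 0 0 a₀ h₀ b hb, (he b hb a₁ h₁).1,
      (he b hb a₁ h₁).2, add_zero]
  · simp only [map_add, LinearMap.add_apply, h 1 1 a₁ h₁ b hb, (he a₀ h₀ b hb).1,
      (he a₀ h₀ b hb).2, zero_add]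

/-- The closedness of a super anti-symmetric form, in the shape of the Jacobi identity. -/
theorem IsClosedForm.leibniz {L : LieSuperalgebra K V} {φ : LinearMap.BilinForm K V}
    (hc : IsClosedForm L φ) (hs : IsSuperAntisymmetric L φ) {i j k : ZMod 2} {a b c : V}
    (ha : a ∈ L.gr i) (hb : b ∈ L.gr j) (hcc : c ∈ L.gr k) :
    φ a (L.bracket b c) =
      φ (L.bracket a b) c + superSign K i j * φ b (L.bracket a c) := by
  have h1 := hc i j k a ha b hb c hcc
  have h2 := hs k (i + j) c hcc _ (L.bracket_mem i j a ha b hb)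
  have h3 := L.skew k i c hcc a ha
  rw [h2, h3] at h1
  rcases parity_cases i with rfl | rfl <;> rcases parity_cases j with rfl | rfl <;>
    rcases parity_cases k with rfl | rfl <;>
    simp only [superSign_zero_left, superSign_zero_right, superSign_one_one, add_zero, zero_add,
      one_add_one_parity, one_smul, one_mul, map_neg, neg_smul, neg_neg] at h1 ⊢ <;>
    first | linear_combination h1 | linear_combination -h1

/-- The relation `ω(D* a, b) = ω(a, D b)`. -/
theorem apply_adjoint_left {L : LieSuperalgebra K V} {ω : LinearMap.BilinForm K V}
    (hs : IsSuperAntisymmetric L ω) (he : IsEvenForm L ω) {D Ds : Module.End K V}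
    (hD : ∀ i : ZMod 2, ∀ a ∈ L.gr i, D a ∈ L.gr i)
    (hadj : ∀ a b, ω (D a) b = ω a (Ds b)) (a b : V) : ω (Ds a) b = ω a (D b) := by
  have key : ∀ j : ZMod 2, ∀ b ∈ L.gr j, ω (Ds a) b = ω a (D b) := by
    intro j b hb
    rw [hs.apply_eq he hb, ← hadj, hs.apply_eq he (hD j b hb)]
  obtain ⟨b₀, h₀, b₁, h₁, rfl⟩ := L.exists_add b
  simp only [map_add, key 0 b₀ h₀, key 1 b₁ h₁]

theorem formC_apply_eq_add {L : LieSuperalgebra K V} {ω : LinearMap.BilinForm K V}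
    (hs : IsSuperAntisymmetric L ω) (he : IsEvenForm L ω) {D Ds : Module.End K V}
    (hD : ∀ i : ZMod 2, ∀ a ∈ L.gr i, D a ∈ L.gr i)
    (hadj : ∀ a b, ω (D a) b = ω a (Ds b)) (a b : V) :
    formC ω D Ds a b = ω (D a) b + ω a (D b) := by
  simp [formC, apply_adjoint_left hs he hD hadj]

/-- The form `Ω` is the image of the form `C` under the action of `D + lam`. -/
theorem formOmega_apply_eq {L : LieSuperalgebra K V} {ω : LinearMap.BilinForm K V}
    (hs : IsSuperAntisymmetric L ω) (he : IsEvenForm L ω) {D Ds : Module.End K V}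
    (hD : ∀ i : ZMod 2, ∀ a ∈ L.gr i, D a ∈ L.gr i)
    (hadj : ∀ a b, ω (D a) b = ω a (Ds b)) (lam : K) (a b : V) :
    formOmega ω D Ds lam a b =
      formC ω D Ds (D a) b + formC ω D Ds a (D b) + lam * formC ω D Ds a b := by
  simp only [formOmega, formC, LinearMap.comp_apply, LinearMap.add_apply, LinearMap.smul_apply,
    Module.End.mul_apply, map_add, map_smul, smul_eq_mul,
    ← apply_adjoint_left hs he hD hadj _ b]
  ring

theorem isEvenForm_formC {L : LieSuperalgebra K V} {ω : LinearMap.BilinForm K V}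
    (hs : IsSuperAntisymmetric L ω) (he : IsEvenForm L ω) {D Ds : Module.End K V}
    (hD : ∀ i : ZMod 2, ∀ a ∈ L.gr i, D a ∈ L.gr i)
    (hadj : ∀ a b, ω (D a) b = ω a (Ds b)) : IsEvenForm L (formC ω D Ds) := by
  intro a ha b hb
  rw [formC_apply_eq_add hs he hD hadj, formC_apply_eq_add hs he hD hadj, (he _ (hD 0 a ha) b hb).1, (he _ (hD 0 a ha) b hb).2,
    (he a ha _ (hD 1 b hb)).1, (he a ha _ (hD 1 b hb)).2]
  simp

/-- The form `C` vanishes at `(a, [a,a])` for odd `a`.  In characteristic `3` this does not follow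
from the closedness of `C`, but it follows from the closedness of `ω` at `(a, a, D a)`. -/
theorem formC_apply_bracket_self {L : LieSuperalgebra K V} {ω : LinearMap.BilinForm K V}
    (hs : IsSuperAntisymmetric L ω) (hc : IsClosedForm L ω) (he : IsEvenForm L ω)
    {D Ds : Module.End K V} (hD : IsEvenDerivation L D)
    (hadj : ∀ a b, ω (D a) b = ω a (Ds b)) {a : V} (ha : a ∈ L.gr 1) :
    formC ω D Ds a (L.bracket a a) = 0 := by
  have hDa := hD.even 1 a ha
  have h1 := hc 1 1 1 a ha a ha (D a) hDa
  have h2 := L.skew 1 1 a ha (D a) hDa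
  rw [formC_apply_eq_add hs he hD.even hadj, hD.leibniz, map_add]
  simp only [superSign_one_one, neg_smul, one_smul, neg_neg] at h1 h2
  rw [h2] at h1 ⊢
  linear_combination -h1

end SuperForms

/-! ### The double extension -/

section DoubleExtension

variable {K V : Type*} [Field K] [AddCommGroup V] [Module K V]

/-- The bracket on `K x ⊕ V ⊕ K x*` with `[x,x*] = lam x`, `[x,a] = 0`,
`[a,b] = [a,b]_V + C(a,b) x` and `[x*,a] = D a + χ(a) x`. -/
def extBracket (B : V →ₗ[K] V →ₗ[K] V) (C : LinearMap.BilinForm K V) (D : Module.End K V)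
    (χ : V →ₗ[K] K) (lam : K) : (K × V × K) →ₗ[K] (K × V × K) →ₗ[K] (K × V × K) :=
  LinearMap.mk₂ K
    (fun u v => (lam * (u.1 * v.2.2 - u.2.2 * v.1) + C u.2.1 v.2.1 + u.2.2 * χ v.2.1
        - v.2.2 * χ u.2.1,
      B u.2.1 v.2.1 + u.2.2 • D v.2.1 - v.2.2 • D u.2.1, (0 : K)))
    (by
      intro u u' v
      refine Prod.ext ?_ (Prod.ext ?_ ?_)
      · simp; ring
      · simp only [Prod.fst_add, Prod.snd_add, map_add, LinearMap.add_apply]; module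
      · simp)
    (by
      intro r u v
      refine Prod.ext ?_ (Prod.ext ?_ ?_)
      · simp; ring
      · simp only [Prod.smul_fst, Prod.smul_snd, map_smul, LinearMap.smul_apply, smul_eq_mul]
        module
      · simp)
    (by
      intro u u' v
      refine Prod.ext ?_ (Prod.ext ?_ ?_)
      · simp; ring
      · simp only [Prod.fst_add, Prod.snd_add, map_add]; module
      · simp)
    (by
      intro r u v
      refine Prod.ext ?_ (Prod.ext ?_ ?_)
      · simp; ring
      · simp only [Prod.smul_fst, Prod.smul_snd, map_smul, smul_eq_mul]
        module
      · simp)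

theorem extBracket_apply (B : V →ₗ[K] V →ₗ[K] V) (C : LinearMap.BilinForm K V)
    (D : Module.End K V) (χ : V →ₗ[K] K) (lam : K) (u v : K × V × K) :
    extBracket B C D χ lam u v =
      (lam * (u.1 * v.2.2 - u.2.2 * v.1) + C u.2.1 v.2.1 + u.2.2 * χ v.2.1 - v.2.2 * χ u.2.1,
        B u.2.1 v.2.1 + u.2.2 • D v.2.1 - v.2.2 • D u.2.1, 0) := rfl

/-- The grading of `K x ⊕ V ⊕ K x*` for which `x` and `x*` are even. -/
def extGr (L : LieSuperalgebra K V) (i : ZMod 2) : Submodule K (K × V × K) where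
  carrier := {v | v.2.1 ∈ L.gr i ∧ (i = 1 → v.1 = 0 ∧ v.2.2 = 0)}
  zero_mem' := by simp
  add_mem' := by
    rintro u v ⟨hu, hu'⟩ ⟨hv, hv'⟩
    refine ⟨Submodule.add_mem _ hu hv, fun hi => ?_⟩
    simp [hu' hi, hv' hi]
  smul_mem' := by
    rintro r v ⟨hv, hv'⟩
    refine ⟨Submodule.smul_mem _ r hv, fun hi => ?_⟩
    simp [hv' hi]

theorem mem_extGr_zero {L : LieSuperalgebra K V} {v : K × V × K} :
    v ∈ extGr L 0 ↔ v.2.1 ∈ L.gr 0 :=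
  ⟨fun h => h.1, fun h => ⟨h, fun h0 => absurd h0 (by decide)⟩⟩

theorem mem_extGr_one {L : LieSuperalgebra K V} {v : K × V × K} :
    v ∈ extGr L 1 ↔ v.1 = 0 ∧ v.2.1 ∈ L.gr 1 ∧ v.2.2 = 0 :=
  ⟨fun h => ⟨(h.2 rfl).1, h.1, (h.2 rfl).2⟩, fun h => ⟨h.2.1, fun _ => ⟨h.1, h.2.2⟩⟩⟩

/-- The conditions on `C`, `D`, `χ` and `lam` under which `extBracket` defines a Lie
superalgebra. -/
structure IsExtensionDatum (L : LieSuperalgebra K V) (C : LinearMap.BilinForm K V)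
    (D : Module.End K V) (χ : V →ₗ[K] K) (lam : K) : Prop where
  antisymm : IsSuperAntisymmetric L C
  closed : IsClosedForm L C
  even : IsEvenForm L C
  apply_bracket_self : ∀ a ∈ L.gr 1, C a (L.bracket a a) = 0
  derivation : IsEvenDerivation L D
  map_odd : ∀ a ∈ L.gr 1, χ a = 0
  derivative : ∀ a b, C (D a) b + C a (D b) + lam * C a b = χ (L.bracket a b)

theorem IsExtensionDatum.extBracket_mem {L : LieSuperalgebra K V} {C : LinearMap.BilinForm K V}
    {D : Module.End K V} {χ : V →ₗ[K] K} {lam : K} (h : IsExtensionDatum L C D χ lam)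
    (i j : ZMod 2) (u : K × V × K) (hu : u ∈ extGr L i) (v : K × V × K) (hv : v ∈ extGr L j) :
    extBracket L.bracket C D χ lam u v ∈ extGr L (i + j) := by
  obtain ⟨s, a, t⟩ := u
  obtain ⟨s', a', t'⟩ := v
  have hm := L.bracket_mem i j a hu.1 a' hv.1
  have hd := h.derivation.even i a hu.1
  have hd' := h.derivation.even j a' hv.1
  rcases parity_cases i with rfl | rfl <;> rcases parity_cases j with rfl | rfl
  · simp only [add_zero, mem_extGr_zero] at hm hu hv ⊢
    exact Submodule.sub_mem _ (Submodule.add_mem _ hm (Submodule.smul_mem _ _ hd'))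
      (Submodule.smul_mem _ _ hd)
  · simp only [zero_add, mem_extGr_zero, mem_extGr_one] at hm hu hv ⊢
    obtain ⟨h1, h2, h3⟩ := hv
    subst h1 h3
    simp only [extBracket_apply, (h.even a hu a' h2).1, h.map_odd a' h2]
    refine ⟨by simp, ?_, trivial⟩
    simpa using Submodule.add_mem _ hm (Submodule.smul_mem _ t hd')
  · simp only [add_zero, mem_extGr_zero, mem_extGr_one] at hm hu hv ⊢
    obtain ⟨h1, h2, h3⟩ := hu
    subst h1 h3
    simp only [extBracket_apply, (h.even a' hv a h2).2, h.map_odd a h2]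
    refine ⟨by simp, ?_, trivial⟩
    simpa using Submodule.sub_mem _ hm (Submodule.smul_mem _ t' hd)
  · simp only [one_add_one_parity, mem_extGr_zero, mem_extGr_one] at hm hu hv ⊢
    simp only [extBracket_apply, hu.2.2, hv.2.2, zero_smul, add_zero, sub_zero]
    exact hm

theorem IsExtensionDatum.extBracket_skew {L : LieSuperalgebra K V} {C : LinearMap.BilinForm K V}
    {D : Module.End K V} {χ : V →ₗ[K] K} {lam : K} (h : IsExtensionDatum L C D χ lam)
    (i j : ZMod 2) (u : K × V × K) (hu : u ∈ extGr L i) (v : K × V × K) (hv : v ∈ extGr L j) :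
    extBracket L.bracket C D χ lam u v =
      -(superSign K i j • extBracket L.bracket C D χ lam v u) := by
  obtain ⟨s, a, t⟩ := u
  obtain ⟨s', a', t'⟩ := v
  have hm := L.skew i j a hu.1 a' hv.1
  have hC := h.antisymm i j a hu.1 a' hv.1
  have hu' : i = 1 → s = 0 ∧ t = 0 := hu.2
  have hv' : j = 1 → s' = 0 ∧ t' = 0 := hv.2
  simp only [extBracket_apply, hm, hC]
  rcases parity_cases i with rfl | rfl <;> rcases parity_cases j with rfl | rfl <;>
    (try obtain ⟨rfl, rfl⟩ := hu' rfl) <;> (try obtain ⟨rfl, rfl⟩ := hv' rfl) <;>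
    refine Prod.ext ?_ (Prod.ext ?_ ?_) <;>
    simp <;> first | ring | abel

theorem IsExtensionDatum.extBracket_jacobi {L : LieSuperalgebra K V} {C : LinearMap.BilinForm K V}
    {D : Module.End K V} {χ : V →ₗ[K] K} {lam : K} (h : IsExtensionDatum L C D χ lam)
    (i j k : ZMod 2) (u : K × V × K) (hu : u ∈ extGr L i) (v : K × V × K) (hv : v ∈ extGr L j)
    (w : K × V × K) (hw : w ∈ extGr L k) :
    extBracket L.bracket C D χ lam u (extBracket L.bracket C D χ lam v w) =
      extBracket L.bracket C D χ lam (extBracket L.bracket C D χ lam u v) w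
        + superSign K i j •
          extBracket L.bracket C D χ lam v (extBracket L.bracket C D χ lam u w) := by
  obtain ⟨s, a, t⟩ := u
  obtain ⟨s', b, t'⟩ := v
  obtain ⟨s'', c, t''⟩ := w
  have hJ := L.jacobi i j k a hu.1 b hv.1 c hw.1
  have hC := h.closed.leibniz h.antisymm hu.1 hv.1 hw.1
  have hS := L.skew j i b hv.1 (D a) (h.derivation.even i a hu.1)
  have hT := h.antisymm j i b hv.1 (D a) (h.derivation.even i a hu.1)
  have k1 : t * (C (D b) c + C b (D c) + lam * C b c) = t * χ (L.bracket b c) := by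
    rw [h.derivative]
  have k2 : t' * (C (D a) c + C a (D c) + lam * C a c) = t' * χ (L.bracket a c) := by
    rw [h.derivative]
  have k3 : t'' * (C (D a) b + C a (D b) + lam * C a b) = t'' * χ (L.bracket a b) := by
    rw [h.derivative]
  have hu' : i = 1 → s = 0 ∧ t = 0 := hu.2
  have hv' : j = 1 → s' = 0 ∧ t' = 0 := hv.2
  have hw' : k = 1 → s'' = 0 ∧ t'' = 0 := hw.2
  have hl := h.derivation.leibniz
  clear hu hv hw
  simp only [extBracket_apply]
  refine Prod.ext ?_ (Prod.ext ?_ ?_)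
  · simp only [Prod.fst_add, Prod.smul_fst, map_add, map_sub, map_smul, LinearMap.add_apply,
      LinearMap.sub_apply, LinearMap.smul_apply, smul_eq_mul, hC, hT]
    rcases parity_cases i with rfl | rfl <;> rcases parity_cases j with rfl | rfl <;>
      rcases parity_cases k with rfl | rfl <;>
      (try obtain ⟨rfl, rfl⟩ := hu' rfl) <;> (try obtain ⟨rfl, rfl⟩ := hv' rfl) <;>
      (try obtain ⟨rfl, rfl⟩ := hw' rfl) <;>
      simp only [superSign_zero_left, superSign_zero_right, superSign_one_one] <;>
      linear_combination -k1 + k2 - k3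
  · simp only [Prod.fst_add, Prod.snd_add, Prod.smul_fst, Prod.smul_snd, map_add, map_sub,
      map_smul, LinearMap.add_apply, LinearMap.sub_apply, LinearMap.smul_apply, hJ, hS, hl]
    rcases parity_cases i with rfl | rfl <;> rcases parity_cases j with rfl | rfl <;>
      rcases parity_cases k with rfl | rfl <;>
      (try obtain ⟨rfl, rfl⟩ := hu' rfl) <;> (try obtain ⟨rfl, rfl⟩ := hv' rfl) <;>
      (try obtain ⟨rfl, rfl⟩ := hw' rfl) <;>
      simp only [superSign_zero_left, superSign_zero_right, superSign_one_one] <;>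
      module
  · simp

/-- The Lie superalgebra `K x ⊕ V ⊕ K x*` attached to an extension datum. -/
def extSuperalgebra {L : LieSuperalgebra K V} {C : LinearMap.BilinForm K V}
    {D : Module.End K V} {χ : V →ₗ[K] K} {lam : K} (h : IsExtensionDatum L C D χ lam) :
    LieSuperalgebra K (K × V × K) where
  gr := extGr L
  isCompl := by
    rw [isCompl_iff, Submodule.disjoint_def, codisjoint_iff, Submodule.eq_top_iff']
    refine ⟨fun v h0 h1 => ?_, fun v => ?_⟩
    · rw [mem_extGr_zero] at h0
      rw [mem_extGr_one] at h1
      refine Prod.ext h1.1 (Prod.ext ?_ h1.2.2)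
      exact Submodule.disjoint_def.1 L.isCompl.disjoint _ h0 h1.2.1
    · obtain ⟨a₀, h₀, a₁, h₁, e⟩ := L.exists_add v.2.1
      refine Submodule.mem_sup.2 ⟨(v.1, a₀, v.2.2), mem_extGr_zero.2 h₀, (0, a₁, 0),
        mem_extGr_one.2 ⟨rfl, h₁, rfl⟩, ?_⟩
      ext <;> simp [e]
  bracket := extBracket L.bracket C D χ lam
  bracket_mem := fun i j u hu v hv => h.extBracket_mem i j u hu v hv
  skew := fun i j u hu v hv => h.extBracket_skew i j u hu v hv
  jacobi := fun i j k u hu v hv w hw => h.extBracket_jacobi i j k u hu v hv w hw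
  odd_cube := by
    rintro ⟨s, a, t⟩ hv
    obtain ⟨h1, h2, h3⟩ := mem_extGr_one.1 hv
    simp only at h1 h2 h3
    subst h1 h3
    simp [extBracket_apply, L.odd_cube a h2, h.apply_bracket_self a h2]

/-- The form on `K x ⊕ V ⊕ K x*` that extends `ω` and makes `K x ⊕ K x*` a hyperbolic plane
orthogonal to `V`. -/
def extForm (ω : LinearMap.BilinForm K V) : LinearMap.BilinForm K (K × V × K) :=
  LinearMap.mk₂ K (fun u v => ω u.2.1 v.2.1 + u.2.2 * v.1 - u.1 * v.2.2)
    (by intros; simp; ring) (by intros; simp; ring) (by intros; simp; ring) (by intros; simp; ring)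

theorem extForm_apply (ω : LinearMap.BilinForm K V) (u v : K × V × K) :
    extForm ω u v = ω u.2.1 v.2.1 + u.2.2 * v.1 - u.1 * v.2.2 := rfl

theorem isExtendedForm_extForm (ω : LinearMap.BilinForm K V) : IsExtendedForm ω (extForm ω) := by
  constructor <;> simp [extForm_apply, extIncl, extX, extXStar]

theorem extForm_nondegenerate {ω : LinearMap.BilinForm K V} (h : ω.Nondegenerate) :
    (extForm ω).Nondegenerate := by
  refine ⟨fun u hu => ?_, fun u hu => ?_⟩
  · refine Prod.ext ?_ (Prod.ext ?_ ?_)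
    · simpa [extForm_apply] using hu (0, 0, 1)
    · exact h.1 _ fun a => by simpa [extForm_apply] using hu (0, a, 0)
    · simpa [extForm_apply] using hu (1, 0, 0)
  · refine Prod.ext ?_ (Prod.ext ?_ ?_)
    · simpa [extForm_apply] using hu (0, 0, 1)
    · exact h.2 _ fun a => by simpa [extForm_apply] using hu (0, a, 0)
    · simpa [extForm_apply] using hu (1, 0, 0)

theorem isOrthosymplecticQuasiFrobenius_extForm {L : LieSuperalgebra K V}
    {ω : LinearMap.BilinForm K V} (hω : IsOrthosymplecticQuasiFrobenius L ω)
    {C : LinearMap.BilinForm K V} {D : Module.End K V} {χ : V →ₗ[K] K} {lam : K}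
    (h : IsExtensionDatum L C D χ lam) (hC : ∀ a b, C a b = ω (D a) b + ω a (D b)) :
    IsOrthosymplecticQuasiFrobenius (extSuperalgebra h) (extForm ω) where
  antisymm := by
    rintro i j ⟨s, a, t⟩ hu ⟨s', a', t'⟩ hv
    have ha := hω.antisymm i j a hu.1 a' hv.1
    have hu' : i = 1 → s = 0 ∧ t = 0 := hu.2
    have hv' : j = 1 → s' = 0 ∧ t' = 0 := hv.2
    simp only [extForm_apply, ha]
    rcases parity_cases i with rfl | rfl <;> rcases parity_cases j with rfl | rfl <;>
      (try obtain ⟨rfl, rfl⟩ := hu' rfl) <;> (try obtain ⟨rfl, rfl⟩ := hv' rfl) <;>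
      simp <;> ring
  closed := by
    rintro i j k ⟨s, a, t⟩ hu ⟨s', b, t'⟩ hv ⟨s'', c, t''⟩ hw
    have hc := hω.closed i j k a hu.1 b hv.1 c hw.1
    have ha' := h.derivation.even i a hu.1
    have hb' := h.derivation.even j b hv.1
    have hc' := h.derivation.even k c hw.1
    have e1 := hω.antisymm k i c hw.1 (D a) ha'
    have e2 := hω.antisymm k j c hw.1 (D b) hb'
    have e3 := hω.antisymm j i b hv.1 (D a) ha'
    have e4 := hω.antisymm i j a hu.1 (D b) hb'
    have e5 := hω.antisymm i k a hu.1 (D c) hc'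
    have e6 := hω.antisymm j k b hv.1 (D c) hc'
    have f1 := hω.antisymm k i c hw.1 a hu.1
    have hu' : i = 1 → s = 0 ∧ t = 0 := hu.2
    have hv' : j = 1 → s' = 0 ∧ t' = 0 := hv.2
    have hw' : k = 1 → s'' = 0 ∧ t'' = 0 := hw.2
    clear hu hv hw
    change superSign K i k * extForm ω _ (extBracket _ _ _ _ _ _ _)
      + superSign K k j * extForm ω _ (extBracket _ _ _ _ _ _ _)
      + superSign K j i * extForm ω _ (extBracket _ _ _ _ _ _ _) = 0
    simp only [extForm_apply, extBracket_apply, map_add, map_sub, map_smul, smul_eq_mul, hC]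
    rcases parity_cases i with rfl | rfl <;> rcases parity_cases j with rfl | rfl <;>
      rcases parity_cases k with rfl | rfl <;>
      (try obtain ⟨rfl, rfl⟩ := hu' rfl) <;> (try obtain ⟨rfl, rfl⟩ := hv' rfl) <;>
      (try obtain ⟨rfl, rfl⟩ := hw' rfl) <;>
      simp only [superSign_zero_left, superSign_zero_right, superSign_one_one]
        at hc e1 e2 e3 e4 e5 e6 ⊢ <;>
      simp only [e1, e2, e3, e4, e5, e6] <;>
      linear_combination hc
  even := by
    rintro ⟨s, a, t⟩ hu ⟨s', b, t'⟩ hv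
    have hu : a ∈ L.gr 0 := hu.1
    obtain ⟨h1, h2, h3⟩ := mem_extGr_one.1 hv
    simp only at h1 h2 h3
    simp [extForm_apply, h1, h3, hω.even a hu b h2]
  nondegenerate := extForm_nondegenerate hω.nondegenerate

end DoubleExtension

/-! ### The correction term of the double extension -/

section StarSum

variable {K V : Type*} [Field K] [AddCommGroup V] [Module K V]

/-- Left-normed brackets of words in `a` and `b`, sorted by the number of letters `a`, are the
coefficients of an iterated right multiplication by `μ a + b`. -/
theorem sum_words_eq_sum_adCoeff (B : V →ₗ[K] V →ₗ[K] V) (a b c : V) (m : ℕ) (g : ℕ → K) :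
    ∑ w : Fin m → Bool, g (Finset.univ.filter fun i => w i = true).card •
        (List.ofFn fun i => if w i then a else b).foldl (fun u v => B u v) c =
      ∑ j ∈ Finset.range (m + 1), g j • adCoeff B.flip a b c m j := by
  induction m generalizing g with
  | zero => simp [adCoeff]
  | succ m ih =>
    rw [← (Fin.snocEquiv fun _ : Fin (m + 1) => Bool).sum_comp, Fintype.sum_prod_type,
      Fintype.sum_bool]
    have hcard : ∀ (z : Bool) (w : Fin m → Bool),
        (Finset.univ.filter fun i => (Fin.snoc w z : Fin (m + 1) → Bool) i = true).card =
          (Finset.univ.filter fun i => w i = true).card + (if z then 1 else 0) := by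
      intro z w
      simp only [Finset.card_filter, Fin.sum_univ_castSucc, Fin.snoc_castSucc, Fin.snoc_last]
    have hfold : ∀ (z : Bool) (w : Fin m → Bool),
        (List.ofFn fun i => if (Fin.snoc w z : Fin (m + 1) → Bool) i then a else b).foldl
            (fun u v => B u v) c =
          B.flip (if z then a else b)
            ((List.ofFn fun i => if w i then a else b).foldl (fun u v => B u v) c) := by
      intro z w
      rw [List.ofFn_succ']
      simp [List.foldl_append]
    simp only [Fin.snocEquiv_apply, hcard, hfold, ← map_smul, ← map_sum, if_true, add_zero,
      Bool.false_eq_true, if_false]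
    rw [ih, ih fun n => g (n + 1), Finset.sum_range_succ' _ (m + 1)]
    simp only [adCoeff, smul_add, Finset.sum_add_distrib]
    have h1 : ∑ j ∈ Finset.range (m + 1), g j • adCoeff B.flip a b c m j =
        ∑ j ∈ Finset.range (m + 1), g (j + 1) • adCoeff B.flip a b c m (j + 1)
          + g 0 • adCoeff B.flip a b c m 0 := by
      rw [← Finset.sum_range_succ' (fun j => g j • adCoeff B.flip a b c m j),
        Finset.sum_range_succ _ (m + 1), adCoeff_eq_zero _ _ _ _ m (m + 1) (by omega), smul_zero, add_zero]
    rw [h1]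
    simp only [map_add, map_sum, map_smul, add_assoc]

theorem LieSuperalgebra.bracket_mem_even (L : LieSuperalgebra K V) {a b : V} (ha : a ∈ L.gr 0)
    (hb : b ∈ L.gr 0) : L.bracket a b ∈ L.gr 0 := by
  simpa using L.bracket_mem 0 0 a ha b hb

theorem LieSuperalgebra.skew_even (L : LieSuperalgebra K V) {a b : V} (ha : a ∈ L.gr 0)
    (hb : b ∈ L.gr 0) : L.bracket a b = -L.bracket b a := by
  simpa using L.skew 0 0 a ha b hb

theorem LieSuperalgebra.adCoeff_flip_mem (L : LieSuperalgebra K V) {a b c : V} (ha : a ∈ L.gr 0)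
    (hb : b ∈ L.gr 0) (hc : c ∈ L.gr 0) (n j : ℕ) :
    adCoeff L.bracket.flip a b c n j ∈ L.gr 0 := by
  induction n generalizing j with
  | zero =>
    cases j with
    | zero => exact hc
    | succ j => exact Submodule.zero_mem _
  | succ n ih =>
    cases j with
    | zero => exact L.bracket_mem_even (ih 0) hb
    | succ j =>
      exact Submodule.add_mem _ (L.bracket_mem_even (ih j) ha) (L.bracket_mem_even (ih (j + 1)) hb)

theorem LieSuperalgebra.adCoeff_eq_flip (L : LieSuperalgebra K V) {a b : V} (ha : a ∈ L.gr 0)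
    (hb : b ∈ L.gr 0) (haa : L.bracket a a = 0) (n j : ℕ) :
    adCoeff L.bracket a b a (n + 1) j =
      (-1 : K) ^ (n + 1) • adCoeff L.bracket.flip a b (L.bracket a b) n j := by
  have hm := L.adCoeff_flip_mem ha hb (L.bracket_mem_even ha hb)
  induction n generalizing j with
  | zero =>
    match j with
    | 0 => simp [adCoeff, L.skew_even hb ha]
    | 1 => simp [adCoeff, haa]
    | j + 2 => simp [adCoeff]
  | succ n ih =>
    have hs : ∀ (u : V) (_ : u ∈ L.gr 0) (j : ℕ),
        L.bracket u (adCoeff L.bracket.flip a b (L.bracket a b) n j) =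
          -L.bracket (adCoeff L.bracket.flip a b (L.bracket a b) n j) u :=
      fun u hu j => L.skew_even hu (hm n j)
    cases j with
    | zero =>
      rw [adCoeff, ih, map_smul, hs b hb, adCoeff, LinearMap.flip_apply, pow_succ _ (n + 1)]
      module
    | succ j =>
      rw [adCoeff, ih, ih, map_smul, map_smul, hs b hb, hs a ha, adCoeff, LinearMap.flip_apply,
        LinearMap.flip_apply, pow_succ _ (n + 1)]
      module

theorem extBracket_extIncl (B : V →ₗ[K] V →ₗ[K] V) (C : LinearMap.BilinForm K V)
    (D : Module.End K V) (χ : V →ₗ[K] K) (lam : K) (a v : V) {z : K × V × K} (hz : z.2 = (v, 0)) :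
    extBracket B C D χ lam (extIncl K a) z = (C a v, B a v, 0) := by
  simp [extBracket_apply, extIncl, hz]

theorem adCoeff_extBracket_snd (B : V →ₗ[K] V →ₗ[K] V) (C : LinearMap.BilinForm K V)
    (D : Module.End K V) (χ : V →ₗ[K] K) (lam : K) (a b c : V) (n j : ℕ) :
    (adCoeff (extBracket B C D χ lam) (extIncl K a) (extIncl K b) (extIncl K c) n j).2 =
      (adCoeff B a b c n j, 0) := by
  induction n generalizing j with
  | zero => cases j <;> rfl
  | succ n ih =>
    cases j with
    | zero => simp only [adCoeff, extBracket_extIncl _ _ _ _ _ _ _ (ih _)]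
    | succ j => simp [adCoeff, extBracket_extIncl _ _ _ _ _ _ _ (ih _)]

theorem adCoeff_extBracket_fst (B : V →ₗ[K] V →ₗ[K] V) (C : LinearMap.BilinForm K V)
    (D : Module.End K V) (χ : V →ₗ[K] K) (lam : K) (a b c : V) (n j : ℕ) :
    (adCoeff (extBracket B C D χ lam) (extIncl K a) (extIncl K b) (extIncl K c) (n + 1) j).1 =
      (if j = 0 then 0 else C a (adCoeff B a b c n (j - 1))) + C b (adCoeff B a b c n j) := by
  have h := adCoeff_extBracket_snd B C D χ lam a b c n
  cases j with
  | zero => simp [adCoeff, extBracket_extIncl _ _ _ _ _ _ _ (h _)]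
  | succ j => simp [adCoeff, extBracket_extIncl _ _ _ _ _ _ _ (h _)]

theorem starSum_eq (L : LieSuperalgebra K V) {φ : LinearMap.BilinForm K V}
    (hφ : IsSuperAntisymmetric L φ) {p : ℕ} (hp : 2 < p) (hodd : Odd p) {a b : V}
    (ha : a ∈ L.gr 0) (hb : b ∈ L.gr 0) (haa : L.bracket a a = 0) :
    starSum p L φ a b =
      ∑ j ∈ Finset.range (p - 2),
        (((j + 2 : ℕ) : K)⁻¹ * φ a (adCoeff L.bracket a b a (p - 2) j)
          + ((j + 1 : ℕ) : K)⁻¹ * φ b (adCoeff L.bracket a b a (p - 2) j)) := by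
  obtain ⟨m, rfl⟩ : ∃ m, p = m + 3 := ⟨p - 3, by omega⟩
  have hsign : (-1 : K) ^ (m + 1) = -1 := by
    refine Odd.neg_one_pow ?_
    rw [Nat.odd_iff] at hodd ⊢
    omega
  have hm := L.adCoeff_flip_mem ha hb (L.bracket_mem_even ha hb) m
  have key : ∀ (g : ℕ → K) (z : V), z ∈ L.gr 0 → ∑ w : Fin m → Bool,
      g (Finset.univ.filter fun i => w i = true).card *
        φ ((List.ofFn fun i => if w i then a else b).foldl (fun u v => L.bracket u v)
          (L.bracket a b)) z =
      ∑ j ∈ Finset.range (m + 1), g j * φ z (adCoeff L.bracket a b a (m + 1) j) := by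
    intro g z hz
    have h := congrArg (fun v => φ v z) (sum_words_eq_sum_adCoeff L.bracket a b (L.bracket a b) m g)
    simp only [map_sum, map_smul, LinearMap.sum_apply, LinearMap.smul_apply, smul_eq_mul] at h
    rw [h]
    refine Finset.sum_congr rfl fun j _ => ?_
    have h0 := hφ 0 0 _ (hm j) z hz
    rw [L.adCoeff_eq_flip ha hb haa, hsign, h0]
    simp
  rw [starSum, Finset.sum_comm, Fintype.sum_bool]
  simp only [if_true, Bool.false_eq_true, if_false, add_zero]
  have k1 := key (fun n => ((1 + n + 1 : ℕ) : K)⁻¹) a ha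
  have k2 := key (fun n => ((1 + n : ℕ) : K)⁻¹) b hb
  refine (congrArg₂ (· + ·) k1 k2).trans ?_
  rw [← Finset.sum_add_distrib]
  refine Finset.sum_congr rfl fun j _ => ?_
  rw [add_comm 1 j]
  rfl

/-- On `V` the correction term of the double extension is the one of `V`, with the sum in the
`*`-property of a restricted cochain `(C, P)` as coefficient of `x`. -/
theorem sSum_extBracket_extIncl (L : LieSuperalgebra K V) {C : LinearMap.BilinForm K V}
    (hC : IsSuperAntisymmetric L C) (D : Module.End K V) (χ : V →ₗ[K] K) (lam : K) {p : ℕ}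
    (hp : 2 < p) (hodd : Odd p) {a b : V} (ha : a ∈ L.gr 0) (hb : b ∈ L.gr 0)
    (haa : L.bracket a a = 0) :
    sSum p (extBracket L.bracket C D χ lam) (extIncl K a) (extIncl K b) =
      (starSum p L C a b, sSum p L.bracket a b, 0) := by
  obtain ⟨m, rfl⟩ : ∃ m, p = m + 3 := ⟨p - 3, by omega⟩
  refine Prod.ext ?_ ?_
  · have hlast : adCoeff L.bracket a b a (m + 1) (m + 1) = 0 := by
      rw [adCoeff_self_eq_pow, pow_succ, Module.End.mul_apply, haa, map_zero]
    rw [starSum_eq L hC hp hodd ha hb haa]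
    simp only [sSum, sElem, Prod.fst_sum, Prod.smul_fst, smul_eq_mul]
    rw [show m + 3 - 1 = m + 1 + 1 from rfl, show m + 3 - 2 = m + 1 from rfl,
      ← Finset.Ico_add_one_right_eq_Icc, Finset.sum_Ico_eq_sum_range]
    simp only [Nat.add_sub_cancel_left, Nat.add_sub_cancel, adCoeff_extBracket_fst, mul_add,
      Finset.sum_add_distrib]
    congr 1
    · rw [Finset.sum_range_succ']
      simp [add_comm, add_left_comm]
    · rw [Finset.sum_range_succ, hlast]
      simp [add_comm]
  · simp only [sSum, sElem, Prod.snd_sum, Prod.smul_snd, adCoeff_extBracket_snd]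
    refine Prod.ext ?_ ?_
    · simp [Prod.fst_sum]
    · simp [Prod.snd_sum]

end StarSum

/-! ### The `p`-map of the double extension -/

section EvenPart

variable {K V : Type*} [Field K] [AddCommGroup V] [Module K V]

/-- The Lie bracket on the even part of a Lie superalgebra. -/
def LieSuperalgebra.evenBracket (L : LieSuperalgebra K V) :
    L.gr 0 →ₗ[K] L.gr 0 →ₗ[K] L.gr 0 :=
  LinearMap.mk₂ K (fun a b => ⟨L.bracket a b, L.bracket_mem_even a.2 b.2⟩)
    (by intros; ext; simp) (by intros; ext; simp) (by intros; ext; simp) (by intros; ext; simp)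

theorem LieSuperalgebra.coe_evenBracket (L : LieSuperalgebra K V) (a b : L.gr 0) :
    (L.evenBracket a b : V) = L.bracket (a : V) (b : V) := rfl

theorem LieSuperalgebra.isLieBracket_evenBracket (L : LieSuperalgebra K V) :
    IsLieBracket L.evenBracket where
  skew a b := Subtype.ext (L.skew_even a.2 b.2)
  jacobi a b c := Subtype.ext (L.jacobi_even a.2 b.2 c)

theorem LieSuperalgebra.coe_sSum_evenBracket (L : LieSuperalgebra K V) (p : ℕ) (a b : L.gr 0) :
    ((sSum p L.evenBracket a b : L.gr 0) : V) = sSum p L.bracket (a : V) (b : V) :=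
  map_sSum (L.gr 0).subtype (fun _ _ => rfl) p a b

theorem LieSuperalgebra.isBracketRep_evenBracket (L : LieSuperalgebra K V) :
    IsBracketRep L.evenBracket (L.bracket ∘ₗ (L.gr 0).subtype) := by
  intro a b
  refine LinearMap.ext fun c => ?_
  simp [Module.End.mul_apply, L.coe_evenBracket, L.jacobi_even a.2 b.2 c]

theorem LieSuperalgebra.bracket_self_even (L : LieSuperalgebra K V) {p : ℕ} [CharP K p]
    (hp : 2 < p) {a : V} (ha : a ∈ L.gr 0) : L.bracket a a = 0 :=
  congrArg Subtype.val (L.isLieBracket_evenBracket.apply_self hp (⟨a, ha⟩ : L.gr 0))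

theorem LieSuperalgebra.bracket_self_div_two_mem (L : LieSuperalgebra K V) (a : L.gr 1) :
    (2 : K)⁻¹ • L.bracket (a : V) (a : V) ∈ L.gr 0 :=
  Submodule.smul_mem _ _ (one_add_one_parity ▸ L.bracket_mem 1 1 a a.2 a a.2)

/-- A `p`-map on the even part, along the identity, extends to a `p|2p`-structure. -/
def IsPMapAlong.pTwoPStructure {p : ℕ} {L : LieSuperalgebra K V} {f : L.gr 0 →ₗ[K] L.gr 0}
    {q : L.gr 0 → L.gr 0}
    (h : IsPMapAlong p L.evenBracket (L.bracket ∘ₗ (L.gr 0).subtype) f q)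
    (hf : ∀ u, f u = u) : PTwoPStructure p L where
  pMap := q
  twoPMap a := q ⟨(2 : K)⁻¹ • L.bracket (a : V) (a : V), L.bracket_self_div_two_mem a⟩
  ad_pMap a b := by
    have := LinearMap.congr_fun (h.rep_rule a) b
    rwa [hf] at this
  pMap_smul := h.smul_rule
  pMap_add a b := by
    rw [h.add_rule, hf, hf]
    simp only [Submodule.coe_add, L.coe_sSum_evenBracket]
    rfl
  twoPMap_eq a u hu := congrArg q (Subtype.ext hu.symm)

end EvenPart

section AdjointPowers

variable {K V : Type*} [Field K] [AddCommGroup V] [Module K V]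

theorem extBracket_extIncl_pow (B : V →ₗ[K] V →ₗ[K] V) (C : LinearMap.BilinForm K V)
    (D : Module.End K V) (χ : V →ₗ[K] K) (lam : K) (a : V) (n : ℕ) (s t : K) (b : V) :
    (extBracket B C D χ lam (extIncl K a) ^ (n + 2)) (s, b, t) =
      (C a ((B a ^ n) (B a b - t • D a)), (B a ^ (n + 1)) (B a b - t • D a), 0) := by
  induction n with
  | zero => simp [pow_two, Module.End.mul_apply, extBracket_apply, extIncl]
  | succ n ih =>
    rw [pow_succ', Module.End.mul_apply, ih, extBracket_extIncl _ _ _ _ _ _ _ rfl,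
      pow_succ' _ (n + 1), Module.End.mul_apply]

theorem extBracket_extX_pow (B : V →ₗ[K] V →ₗ[K] V) (C : LinearMap.BilinForm K V)
    (D : Module.End K V) (χ : V →ₗ[K] K) (lam : K) (n : ℕ) :
    extBracket B C D χ lam (extX K V) ^ (n + 2) = 0 := by
  refine LinearMap.ext fun z => ?_
  have h : extBracket B C D χ lam (extX K V) (extBracket B C D χ lam (extX K V) z) = 0 := by
    simp [extBracket_apply, extX]
  rw [pow_add, Module.End.mul_apply, pow_two, Module.End.mul_apply, h, map_zero,
    LinearMap.zero_apply]

theorem extBracket_extXStar_pow (B : V →ₗ[K] V →ₗ[K] V) (C : LinearMap.BilinForm K V)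
    (D : Module.End K V) (χ : V →ₗ[K] K) (lam : K) (n : ℕ) (s t : K) (b : V) :
    (extBracket B C D χ lam (extXStar K V) ^ (n + 1)) (s, b, t) =
      ((-lam) ^ (n + 1) * s + ∑ k ∈ Finset.range (n + 1), (-lam) ^ (n - k) * χ ((D ^ k) b),
        (D ^ (n + 1)) b, 0) := by
  induction n with
  | zero => simp [extBracket_apply, extXStar]
  | succ n ih =>
    have h : ∑ k ∈ Finset.range (n + 1), (-lam) ^ (n + 1 - k) * χ ((D ^ k) b) =
        -lam * ∑ k ∈ Finset.range (n + 1), (-lam) ^ (n - k) * χ ((D ^ k) b) := by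
      rw [Finset.mul_sum]
      refine Finset.sum_congr rfl fun k hk => ?_
      have := Finset.mem_range.1 hk
      rw [Nat.succ_sub (by omega), pow_succ']
      ring
    rw [pow_succ', Module.End.mul_apply, ih, Finset.sum_range_succ _ (n + 1), h]
    simp only [extBracket_apply, extXStar]
    refine Prod.ext ?_ (Prod.ext ?_ rfl)
    · simp; ring
    · simp [pow_succ' D (n + 1), Module.End.mul_apply]

theorem LieSuperalgebra.ad_pow_mem (L : LieSuperalgebra K V) {a b : V} {i : ZMod 2}
    (ha : a ∈ L.gr 0) (hb : b ∈ L.gr i) (n : ℕ) : (L.bracket a ^ n) b ∈ L.gr i := by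
  induction n with
  | zero => simpa using hb
  | succ n ih =>
    rw [pow_succ', Module.End.mul_apply]
    simpa using L.bracket_mem 0 i a ha _ ih

theorem LieSuperalgebra.flip_pow_apply (L : LieSuperalgebra K V) {a b : V}
    (ha : a ∈ L.gr 0) (hb : b ∈ L.gr 0) (n : ℕ) :
    (L.bracket.flip a ^ n) b = (-1 : K) ^ n • (L.bracket a ^ n) b := by
  induction n with
  | zero => simp
  | succ n ih =>
    rw [pow_succ', Module.End.mul_apply, ih, LinearMap.flip_apply,
      L.skew_even (Submodule.smul_mem _ _ (L.ad_pow_mem ha hb n)) ha, map_smul,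
      pow_succ' (L.bracket a), Module.End.mul_apply, pow_succ]
    module

theorem IsRestrictedCocycle.apply_pMap_left {p : ℕ} (hodd : Odd p) {L : LieSuperalgebra K V}
    {R : PTwoPStructure p L} {φ : LinearMap.BilinForm K V} {θ : L.gr 0 → K}
    (h : IsRestrictedCocycle R φ θ) (he : IsEvenForm L φ) (a : L.gr 0) (b : V) :
    φ (R.pMap a : V) b = φ (a : V) ((L.bracket (a : V) ^ (p - 1)) b) := by
  obtain ⟨b₀, h₀, b₁, h₁, rfl⟩ := L.exists_add b
  have e0 : φ (R.pMap a : V) b₀ = φ (a : V) ((L.bracket (a : V) ^ (p - 1)) b₀) := by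
    have h1 := h.ind ⟨b₀, h₀⟩ a
    have hm := L.ad_pow_mem a.2 h₀ (p - 1)
    simp only [L.flip_pow_apply a.2 h₀, (Nat.Odd.sub_odd hodd odd_one).neg_one_pow, one_smul,
      h.antisymm 0 0 b₀ h₀ _ (R.pMap a).2, h.antisymm 0 0 _ hm _ a.2, superSign_zero_left,
      one_mul] at h1
    linear_combination -h1
  rw [map_add, map_add, map_add, e0, (he _ (R.pMap a).2 b₁ h₁).1,
    (he _ a.2 _ (L.ad_pow_mem a.2 h₁ (p - 1))).1]

end AdjointPowers

section ExtensionPMap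

variable {K V : Type*} [Field K] [AddCommGroup V] [Module K V]

variable {L : LieSuperalgebra K V} {C : LinearMap.BilinForm K V} {D : Module.End K V}
  {χ : V →ₗ[K] K} {lam : K}

/-- The projection of the even part `K x ⊕ V₀ ⊕ K x*` to `V₀`. -/
def evenComponent (h : IsExtensionDatum L C D χ lam) :
    (extSuperalgebra h).gr 0 →ₗ[K] L.gr 0 where
  toFun v := ⟨(v : K × V × K).2.1, mem_extGr_zero.1 v.2⟩
  map_add' _ _ := rfl
  map_smul' _ _ := rfl

/-- The inclusion of `V₀` in the even part `K x ⊕ V₀ ⊕ K x*`. -/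
def evenIncl (h : IsExtensionDatum L C D χ lam) :
    L.gr 0 →ₗ[K] (extSuperalgebra h).gr 0 where
  toFun a := ⟨extIncl K (a : V), mem_extGr_zero.2 a.2⟩
  map_add' a b := by ext <;> simp [extIncl]
  map_smul' r a := by ext <;> simp [extIncl]

/-- The `p`-map of the double extension: it glues `a ↦ a^{[p]} + P(a) x` on `V₀` with the
`p`-maps on the lines `K x` and `K x*` that send `x` and `x*` to the given images `σ x + b₀ + δ x*`
and `lamT x + a₀ + γ x*`. -/
theorem exists_pTwoPStructure_extSuperalgebra {p : ℕ} [Fact p.Prime] [CharP K p] (hp : 2 < p)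
    (R : PTwoPStructure p L) (h : IsExtensionDatum L C D χ lam) {P : L.gr 0 → K} (hCP : IsRestrictedCocycle R C P)
    (hD : IsEvenRestrictedDerivation R D)
    (hT : ∀ a : L.gr 0, C (a : V) ((L.bracket (a : V) ^ (p - 2)) (D (a : V))) + lam * P a =
      χ (R.pMap a : V))
    {γ lamT σ δ : K} {a₀ b₀ : V} (ha₀ : a₀ ∈ L.gr 0) (hb₀ : b₀ ∈ L.gr 0)
    (hDa₀ : D a₀ = 0) (hDp : D ^ p = γ • D + L.bracket a₀) (hγ : lam * γ = lam ^ p)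
    (hlamT : lam * lamT = χ a₀)
    (hsum : ∀ b, C a₀ b + γ * χ b =
      ∑ k ∈ Finset.range p, (-lam) ^ (p - 1 - k) * χ ((D ^ k) b))
    (hδ : lam * δ = 0) (hσ : lam * σ = χ b₀) (hDb₀ : D b₀ = 0)
    (hCb₀ : ∀ b, C b₀ b + δ * χ b = 0) (hbb₀ : ∀ b, L.bracket b₀ b + δ • D b = 0) :
    ∃ RG : PTwoPStructure p (extSuperalgebra h), IsExtendedPMap R P γ lamT σ δ a₀ b₀ RG := by
  have hodd : Odd p := (Fact.out : p.Prime).odd_of_ne_two (by omega)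
  obtain ⟨m, hm⟩ : ∃ m, p = m + 2 := ⟨p - 2, by omega⟩
  have hB := (extSuperalgebra h).isLieBracket_evenBracket
  have hρ := (extSuperalgebra h).isBracketRep_evenBracket
  let f₁ : (extSuperalgebra h).gr 0 →ₗ[K] (extSuperalgebra h).gr 0 := evenIncl h ∘ₗ evenComponent h
  let q₁ : (extSuperalgebra h).gr 0 → (extSuperalgebra h).gr 0 := fun v =>
    ⟨(P (evenComponent h v), (R.pMap (evenComponent h v) : V), 0), mem_extGr_zero.2 (Subtype.mem _)⟩
  have h₁ : IsPMapAlong p (extSuperalgebra h).evenBracket ((extSuperalgebra h).bracket ∘ₗ ((extSuperalgebra h).gr 0).subtype) f₁ q₁ := by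
    refine ⟨fun r v => ?_, fun v w => ?_, fun v => ?_⟩
    · refine Subtype.ext ?_
      simp only [q₁, map_smul, hCP.star.smul, R.pMap_smul, Submodule.coe_smul]
      simp
    · refine Subtype.ext ?_
      have e : sSum p (extSuperalgebra h).bracket (f₁ v : K × V × K) (f₁ w : K × V × K) = _ :=
        sSum_extBracket_extIncl L h.antisymm D χ lam hp hodd
          (evenComponent h v).2 (evenComponent h w).2
          (L.bracket_self_even hp (evenComponent h v).2)
      rw [Submodule.coe_add, (extSuperalgebra h).coe_sSum_evenBracket, e]
      simp only [q₁, map_add, hCP.star.add, R.pMap_add, Submodule.coe_add]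
      simp [sSum]
    · set a := evenComponent h v with ha
      refine LinearMap.ext ?_
      rintro ⟨s, b, t⟩
      change extBracket L.bracket C D χ lam (P a, (R.pMap a : V), 0) (s, b, t) =
        (extBracket L.bracket C D χ lam (extIncl K (a : V)) ^ p) (s, b, t)
      have e1 := hCP.apply_pMap_left hodd h.even a b
      have e2 := hT a
      have e3 := hD.map_pMap a
      have e4 := R.ad_pMap a b
      subst hm
      rw [show m + 2 - 1 = m + 1 from rfl] at e1 e3
      rw [show m + 2 - 2 = m from rfl] at e2
      rw [extBracket_extIncl_pow, extBracket_apply]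
      refine Prod.ext ?_ (Prod.ext ?_ rfl)
      · simp only [e1, map_sub, map_smul, smul_eq_mul, pow_succ, Module.End.mul_apply]
        linear_combination t * e2
      · simp only [e3, e4, map_sub, map_smul, pow_succ, Module.End.mul_apply]
        simp
  let ex : (extSuperalgebra h).gr 0 := ⟨extX K V, mem_extGr_zero.2 (Submodule.zero_mem _)⟩
  let es : (extSuperalgebra h).gr 0 := ⟨extXStar K V, mem_extGr_zero.2 (Submodule.zero_mem _)⟩
  let yx : (extSuperalgebra h).gr 0 := ⟨(σ, b₀, δ), mem_extGr_zero.2 hb₀⟩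
  let ys : (extSuperalgebra h).gr 0 := ⟨(lamT, a₀, γ), mem_extGr_zero.2 ha₀⟩
  let lx : (extSuperalgebra h).gr 0 →ₗ[K] K := LinearMap.fst K K (V × K) ∘ₗ ((extSuperalgebra h).gr 0).subtype
  let ls : (extSuperalgebra h).gr 0 →ₗ[K] K :=
    LinearMap.snd K V K ∘ₗ LinearMap.snd K K (V × K) ∘ₗ ((extSuperalgebra h).gr 0).subtype
  have hx : ((extSuperalgebra h).bracket ∘ₗ ((extSuperalgebra h).gr 0).subtype) yx = ((extSuperalgebra h).bracket ∘ₗ ((extSuperalgebra h).gr 0).subtype) ex ^ p := by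
    change extBracket L.bracket C D χ lam (σ, b₀, δ) =
      extBracket L.bracket C D χ lam (extX K V) ^ p
    rw [hm, extBracket_extX_pow]
    refine LinearMap.ext ?_
    rintro ⟨s, b, t⟩
    rw [extBracket_apply]
    refine Prod.ext ?_ (Prod.ext ?_ rfl)
    · simp only [LinearMap.zero_apply, Prod.fst_zero]
      linear_combination t * hσ - s * hδ + hCb₀ b
    · simp [hDb₀, hbb₀]
  have hs : ((extSuperalgebra h).bracket ∘ₗ ((extSuperalgebra h).gr 0).subtype) ys = ((extSuperalgebra h).bracket ∘ₗ ((extSuperalgebra h).gr 0).subtype) es ^ p := by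
    change extBracket L.bracket C D χ lam (lamT, a₀, γ) =
      extBracket L.bracket C D χ lam (extXStar K V) ^ p
    refine LinearMap.ext ?_
    rintro ⟨s, b, t⟩
    have e := extBracket_extXStar_pow L.bracket C D χ lam (p - 1) s t b
    rw [Nat.sub_add_cancel (by omega), ← hsum, hDp, hodd.neg_pow] at e
    rw [e, extBracket_apply]
    refine Prod.ext ?_ (Prod.ext ?_ rfl)
    · simp only
      linear_combination t * hlamT - s * hγ
    · simp [hDa₀, add_comm]
  have h₂ := isPMapAlong_line hB hp lx hx
  have h₃ := isPMapAlong_line hB hp ls hs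
  have h₁₂ := h₁.add hB hp hρ h₂
  have hQ := h₁₂.add hB hp hρ h₃
  have hid : ∀ u, (f₁ + lx.smulRight ex + ls.smulRight es) u = u := by
    rintro ⟨⟨s, a, t⟩, hu⟩
    refine Subtype.ext ?_
    change extIncl K a + s • extX K V + t • extXStar K V = (s, a, t)
    simp [extIncl, extX, extXStar]
  have hq₁ : ∀ u, evenComponent h u = 0 → q₁ u = 0 := by
    intro u hu
    have hP : P 0 = 0 := by simpa [zero_pow (show p ≠ 0 by omega)] using hCP.star.smul 0 0
    have hR : R.pMap 0 = 0 := by simpa [zero_pow (show p ≠ 0 by omega)] using R.pMap_smul 0 0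
    refine Subtype.ext ?_
    change (P (evenComponent h u), (R.pMap (evenComponent h u) : V), (0 : K)) = 0
    rw [hu, hP, hR]
    rfl
  have hf₁ : ∀ u, evenComponent h u = 0 → f₁ u = 0 := by
    intro u hu
    simp [f₁, hu]
  refine ⟨hQ.pTwoPStructure hid, ?_, ?_, ?_⟩
  · rintro a ⟨u, hu⟩ rfl
    change ((q₁ _ + (0 : K) ^ p • yx + sSum p (extSuperalgebra h).evenBracket (f₁ _) ((0 : K) • ex)
      + (0 : K) ^ p • ys + sSum p (extSuperalgebra h).evenBracket (f₁ _ + (0 : K) • ex)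
        ((0 : K) • es) : (extSuperalgebra h).gr 0) : K × V × K) = _
    rw [zero_pow (by omega), zero_smul, zero_smul, zero_smul, zero_smul, sSum_zero_right hB hp,
      sSum_zero_right hB hp]
    simp only [add_zero]
    change (P a, (R.pMap a : V), (0 : K)) = _
    simp [extIncl, extX]
  · rintro ⟨u, hu⟩ rfl
    have h0 : evenComponent h ⟨extXStar K V, hu⟩ = 0 := rfl
    change ((q₁ _ + (0 : K) ^ p • yx + sSum p (extSuperalgebra h).evenBracket (f₁ _) ((0 : K) • ex)
      + (1 : K) ^ p • ys + sSum p (extSuperalgebra h).evenBracket (f₁ _ + (0 : K) • ex)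
        ((1 : K) • es) : (extSuperalgebra h).gr 0) : K × V × K) = _
    rw [hq₁ _ h0, hf₁ _ h0, zero_pow (by omega), zero_smul, zero_smul, one_pow, one_smul, add_zero,
      sSum_zero_left _ hp, sSum_zero_left _ hp]
    simp only [add_zero, zero_add]
    change (lamT, a₀, γ) = _
    simp [extIncl, extX, extXStar]
  · rintro ⟨u, hu⟩ rfl
    have h0 : evenComponent h ⟨extX K V, hu⟩ = 0 := rfl
    change ((q₁ _ + (1 : K) ^ p • yx + sSum p (extSuperalgebra h).evenBracket (f₁ _) ((1 : K) • ex)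
      + (0 : K) ^ p • ys + sSum p (extSuperalgebra h).evenBracket (f₁ _ + (1 : K) • ex)
        ((0 : K) • es) : (extSuperalgebra h).gr 0) : K × V × K) = _
    rw [hq₁ _ h0, hf₁ _ h0, zero_pow (by omega), zero_smul, zero_smul, one_pow, one_smul,
      sSum_zero_left _ hp, sSum_zero_right hB hp]
    simp only [add_zero, zero_add]
    change (σ, b₀, δ) = _
    simp [extIncl, extX, extXStar]

end ExtensionPMap

/-! ### The element `Z` and the three families of parameters -/

section Main

variable {K V : Type*} [Field K] [AddCommGroup V] [Module K V]

theorem exists_isZOmega [FiniteDimensional K V] {p : ℕ} {L : LieSuperalgebra K V}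
    (R : PTwoPStructure p L) {ω : LinearMap.BilinForm K V}
    (hω : IsOrthosymplecticQuasiFrobenius L ω) {D Ds : Module.End K V}
    (hD : IsEvenDerivation L D) (hadj : ∀ a b, ω (D a) b = ω a (Ds b)) (lam : K) (P : L.gr 0 → K)
    (h : IsRestrictedCoboundary R (formOmega ω D Ds lam) (mapT p L ω D Ds lam P)) :
    ∃ Z : V, IsZOmega R ω D Ds lam P Z := by
  obtain ⟨χ, h1, h2⟩ := h.exists_primitive
  obtain ⟨Z₀, hZ₀, Z₁, hZ₁, e⟩ :=
    L.exists_add ((LinearMap.BilinForm.toDual ω hω.nondegenerate).symm χ)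
  have hχ : ∀ v, χ v = ω Z₀ v + ω Z₁ v := by
    intro v
    rw [← LinearMap.add_apply, ← map_add, e]
    exact (LinearMap.BilinForm.apply_toDual_symm_apply χ v).symm
  have hχ0 : ∀ v ∈ L.gr 0, χ v = ω Z₀ v := by
    intro v hv
    rw [hχ, (hω.even v hv Z₁ hZ₁).2, add_zero]
  -- on pairs of different parities `Ω` vanishes, so that the odd part of `Z` does not matter
  have hΩ0 : ∀ a ∈ L.gr 0, ∀ b ∈ L.gr 1,
      formOmega ω D Ds lam a b = 0 ∧ formOmega ω D Ds lam b a = 0 := by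
    intro a ha b hb
    have hC := isEvenForm_formC hω.antisymm hω.even hD.even hadj
    simp only [formOmega_apply_eq hω.antisymm hω.even hD.even hadj, (hC a ha b hb).1,
      (hC a ha b hb).2, (hC _ (hD.even 0 a ha) b hb).1, (hC _ (hD.even 0 a ha) b hb).2,
      (hC a ha _ (hD.even 1 b hb)).1, (hC a ha _ (hD.even 1 b hb)).2]
    simp
  have hZ1 : ∀ v ∈ L.gr 1, ω Z₀ v = 0 := fun v hv => (hω.even Z₀ hZ₀ v hv).1
  refine ⟨Z₀, hZ₀, fun a b => ?_, fun a => ?_⟩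
  · obtain ⟨a₀, ha₀, a₁, ha₁, rfl⟩ := L.exists_add a
    obtain ⟨b₀, hb₀, b₁, hb₁, rfl⟩ := L.exists_add b
    have m01 := L.bracket_mem 0 1 a₀ ha₀ b₁ hb₁
    have m10 := L.bracket_mem 1 0 a₁ ha₁ b₀ hb₀
    have m11 := L.bracket_mem 1 1 a₁ ha₁ b₁ hb₁
    rw [zero_add] at m01
    rw [add_zero] at m10
    rw [one_add_one_parity] at m11
    simp only [map_add, LinearMap.add_apply, (hΩ0 _ ha₀ _ hb₁).1, (hΩ0 _ hb₀ _ ha₁).2,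
      hZ1 _ m01, hZ1 _ m10]
    rw [h1, h1, hχ0 _ (L.bracket_mem_even ha₀ hb₀), hχ0 _ m11]
  · rw [h2, hχ0 _ (R.pMap a).2]

theorem isExtensionDatum_formC {p : ℕ} {L : LieSuperalgebra K V} {R : PTwoPStructure p L}
    {ω : LinearMap.BilinForm K V} (hω : IsOrthosymplecticQuasiFrobenius L ω)
    {D Ds : Module.End K V} (hD : IsEvenDerivation L D) (hadj : ∀ a b, ω (D a) b = ω a (Ds b))
    {lam : K} {P : L.gr 0 → K} (hCP : IsRestrictedCocycle R (formC ω D Ds) P) {Z : V}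
    (hZ : IsZOmega R ω D Ds lam P Z) : IsExtensionDatum L (formC ω D Ds) D (ω Z) lam where
  antisymm := hCP.antisymm
  closed := hCP.closed
  even := isEvenForm_formC hω.antisymm hω.even hD.even hadj
  apply_bracket_self _ ha := formC_apply_bracket_self hω.antisymm hω.closed hω.even hD hadj ha
  derivation := hD
  map_odd a ha := (hω.even Z hZ.mem a ha).1
  derivative a b := by
    rw [← hZ.omega_eq, formOmega_apply_eq hω.antisymm hω.even hD.even hadj]

theorem isDoubleExtension_extSuperalgebra {L : LieSuperalgebra K V}
    {ω : LinearMap.BilinForm K V} {D Ds : Module.End K V} {lam : K} {Z : V}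
    (h : IsExtensionDatum L (formC ω D Ds) D (ω Z) lam) :
    IsDoubleExtension L ω D Ds lam Z (extSuperalgebra h) where
  mem_gr_zero _ := mem_extGr_zero
  mem_gr_one _ := mem_extGr_one
  bracket_x_xStar := by simp [extSuperalgebra, extBracket_apply, extX, extXStar]
  bracket_x_incl a := by simp [extSuperalgebra, extBracket_apply, extX, extIncl]
  bracket_incl a b := by simp [extSuperalgebra, extBracket_apply, extX, extIncl, formC]
  bracket_xStar_incl a := by
    simp [extSuperalgebra, extBracket_apply, extX, extXStar, extIncl]

/-- The condition on `a₀` for the `p`-th power of `ad x*`, tested against `V`. -/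
theorem formC_add_eq_sum {ω : LinearMap.BilinForm K V} {D Ds : Module.End K V}
    (hadj' : ∀ a b, ω (Ds a) b = ω a (D b)) {p : ℕ} {lam γ : K} {Z a₀ : V} (hDa₀ : D a₀ = 0)
    (h : Ds a₀ + γ • Z = ∑ k ∈ Finset.range p, (-lam) ^ (p - 1 - k) • (Ds ^ k) Z) (b : V) :
    formC ω D Ds a₀ b + γ * ω Z b =
      ∑ k ∈ Finset.range p, (-lam) ^ (p - 1 - k) * ω Z ((D ^ k) b) := by
  have hpow : ∀ (k : ℕ) (b : V), ω ((Ds ^ k) Z) b = ω Z ((D ^ k) b) := by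
    intro k
    induction k with
    | zero => simp
    | succ k ih =>
      intro b
      rw [pow_succ', Module.End.mul_apply, hadj', ih, pow_succ, Module.End.mul_apply]
  have e := congrArg (fun v => ω v b) h
  simp only [map_add, map_smul, map_sum, LinearMap.add_apply, LinearMap.smul_apply,
    LinearMap.sum_apply, smul_eq_mul, hpow] at e
  simpa [formC, hDa₀] using e

end Main

theorem theorem3p1 {K V : Type*} [Field K] [AddCommGroup V] [Module K V] [FiniteDimensional K V]
    (p : ℕ) [Fact p.Prime] [CharP K p] (hp : 2 < p)
    (L : LieSuperalgebra K V) (R : PTwoPStructure p L)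
    (ω : LinearMap.BilinForm K V) (hω : IsOrthosymplecticQuasiFrobenius L ω)
    (D Ds : Module.End K V) (hD : IsEvenRestrictedDerivation R D)
    (hDs : Ds = formAdjoint ω hω.nondegenerate D)
    (lam : K) (P : L.gr 0 → K)
    (hΩT : IsRestrictedCoboundary R (formOmega ω D Ds lam) (mapT p L ω D Ds lam P))
    (hCP : IsRestrictedCocycle R (formC ω D Ds) P) :
    (∃ Z : V, IsZOmega R ω D Ds lam P Z) ∧
    ∀ Z : V, IsZOmega R ω D Ds lam P Z →
      ∃ G : LieSuperalgebra K (K × V × K),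
        IsDoubleExtension L ω D Ds lam Z G ∧
        (∃ ωG : LinearMap.BilinForm K (K × V × K),
          IsExtendedForm ω ωG ∧ IsOrthosymplecticQuasiFrobenius G ωG) ∧
        ∀ (γ lamT σ δ : K) (a₀ b₀ : V),
          IsPPropertyWitness p L D γ a₀ → b₀ ∈ L.gr 0 →
          ((lam ≠ 0 ∧ D a₀ = 0 ∧ lamT = lam⁻¹ * ω Z a₀ ∧ γ = lam ^ (p - 1) ∧ δ = 0 ∧
              D b₀ = 0 ∧ σ = lam⁻¹ * ω Z b₀ ∧ Ds b₀ = 0 ∧ b₀ ∈ L.center ∧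
              Ds a₀ = ∑ i ∈ Finset.Icc 1 (p - 1),
                ((-1 : K) ^ (p - 1 - i) * lam ^ (p - 1 - i)) • (Ds ^ i) Z) ∨
            (lam = 0 ∧ δ = 0 ∧ D a₀ = 0 ∧ ω Z a₀ = 0 ∧
              D b₀ = 0 ∧ ω Z b₀ = 0 ∧ Ds b₀ = 0 ∧ b₀ ∈ L.center ∧
              Ds a₀ + γ • Z = (Ds ^ (p - 1)) Z) ∨
            (lam = 0 ∧ δ ≠ 0 ∧ D = -(δ⁻¹ • L.bracket b₀) ∧ D a₀ = 0 ∧ ω Z a₀ = 0 ∧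
              D b₀ = 0 ∧ ω Z b₀ = 0 ∧ Ds b₀ = -(δ • Z) ∧
              Ds a₀ + γ • Z = (Ds ^ (p - 1)) Z)) →
          ∃ RG : PTwoPStructure p G, IsExtendedPMap R P γ lamT σ δ a₀ b₀ RG := by
  have hadj : ∀ a b, ω (D a) b = ω a (Ds b) := by
    rw [hDs]
    exact apply_formAdjoint ω hω.nondegenerate D
  have hder := hD.toIsEvenDerivation
  have hadj' := apply_adjoint_left hω.antisymm hω.even hder.even hadj
  have hodd : Odd p := (Fact.out : p.Prime).odd_of_ne_two (by omega)
  have heven : Even (p - 1) := Nat.Odd.sub_odd hodd odd_one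
  refine ⟨exists_isZOmega R hω hder hadj lam P hΩT, fun Z hZ => ?_⟩
  have h := isExtensionDatum_formC hω hder hadj hCP hZ
  refine ⟨extSuperalgebra h, isDoubleExtension_extSuperalgebra h, ⟨extForm ω,
    isExtendedForm_extForm ω, isOrthosymplecticQuasiFrobenius_extForm hω h
      (formC_apply_eq_add hω.antisymm hω.even hder.even hadj)⟩, ?_⟩
  intro γ lamT σ δ a₀ b₀ hp₀ hb₀ hcases
  have hT : ∀ a : L.gr 0, formC ω D Ds (a : V) ((L.bracket (a : V) ^ (p - 2)) (D (a : V)))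
      + lam * P a = ω Z (R.pMap a : V) := hZ.map_eq
  -- for `lam = 0` only the last term of the sum over the powers of `D*` is left
  have hsum0 : lam = 0 → Ds a₀ + γ • Z = (Ds ^ (p - 1)) Z →
      Ds a₀ + γ • Z = ∑ k ∈ Finset.range p, (-lam) ^ (p - 1 - k) • (Ds ^ k) Z := by
    rintro rfl h0
    rw [h0, Finset.sum_eq_single (p - 1)]
    · simp
    · intro k hk hk'
      have := Finset.mem_range.1 hk
      rw [neg_zero, zero_pow (by omega), zero_smul]
    · intro hn
      exact absurd (Finset.mem_range.2 (by omega)) hn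
  have hp0 : p ≠ 0 := by omega
  rcases hcases with ⟨hl, hDa, hlT, hγ, hδ, hDb, hσ, hDsb, hcen, hDsa⟩ |
    ⟨hl, hδ, hDa, hZa, hDb, hZb, hDsb, hcen, hDsa⟩ |
    ⟨hl, hδ, hDad, hDa, hZa, hDb, hZb, hDsb, hDsa⟩
  · have hsum : Ds a₀ + γ • Z = ∑ k ∈ Finset.range p, (-lam) ^ (p - 1 - k) • (Ds ^ k) Z := by
      rw [Finset.range_eq_Ico, Finset.sum_eq_sum_Ico_succ_bot (by omega), hDsa, hγ, add_comm]
      have h6 : Finset.Ico (0 + 1) p = Finset.Icc 1 (p - 1) := by ext; simp; omega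
      rw [h6]
      congr 1
      · simp [heven.neg_pow]
      · refine Finset.sum_congr rfl fun k _ => ?_
        rw [← mul_pow, neg_one_mul]
    refine exists_pTwoPStructure_extSuperalgebra hp R h hCP hD hT hp₀.mem hb₀ hDa hp₀.pow_eq
      ?_ ?_ (formC_add_eq_sum hadj' hDa hsum) ?_ ?_ hDb ?_ ?_
    · rw [hγ, ← pow_succ', Nat.sub_add_cancel (by omega)]
    · rw [hlT, mul_inv_cancel_left₀ hl]
    · rw [hδ, mul_zero]
    · rw [hσ, mul_inv_cancel_left₀ hl]
    · intro b
      simp [formC, hDb, hDsb, hδ]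
    · intro b
      simp [hcen b, hδ]
  · refine exists_pTwoPStructure_extSuperalgebra hp R h hCP hD hT hp₀.mem hb₀ hDa hp₀.pow_eq
      ?_ ?_ (formC_add_eq_sum hadj' hDa (hsum0 hl hDsa)) ?_ ?_ hDb ?_ ?_
    · simp [hl, hp0]
    · simp [hl, hZa]
    · simp [hl]
    · simp [hl, hZb]
    · intro b
      simp [formC, hDb, hDsb, hδ]
    · intro b
      simp [hcen b, hδ]
  · refine exists_pTwoPStructure_extSuperalgebra hp R h hCP hD hT hp₀.mem hb₀ hDa hp₀.pow_eq
      ?_ ?_ (formC_add_eq_sum hadj' hDa (hsum0 hl hDsa)) ?_ ?_ hDb ?_ ?_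
    · simp [hl, hp0]
    · simp [hl, hZa]
    · simp [hl]
    · simp [hl, hZb]
    · intro b
      simp [formC, hDb, hDsb]
    · intro b
      have e := congrArg (δ • ·) (LinearMap.congr_fun hDad b)
      simp only [LinearMap.neg_apply, LinearMap.smul_apply, smul_neg, smul_smul,
        mul_inv_cancel₀ hδ, one_smul] at e
      rw [e, add_neg_cancel]
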